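/- Let $0<\beta<4\pi$ and $R_\beta=\dfrac{4\pi-\beta}{4\pi e\beta}$. Consider the two-dimensional Yukawa gas: the particles $\xi_i=(x_i,\sigma_i)$ have positions $x_i\in\mathbb R^2$ and charges $\sigma_i\in\{-1,1\}$, and $\rho$ is Lebesgue measure on $\mathbb R^2$ times the uniform probability measure on $\{-1,1\}$. The pair interaction, multiplied by the inverse temperature $\beta$, is $\sigma_i\sigma_j\,v(x_i-x_j)$. The gas without cutoff has $v(x)=v_{-\infty}(x)=\beta(-\Delta+1)^{-1}(x)=\frac{\beta}{2\pi}K_0(|x|)$. The gas with ultraviolet cutoff $t_0\le 0$ has $$v(x)=v_{t_0}(x)=\beta(-\Delta+\kappa(0))^{-1}(x)-\beta(-\Delta+\kappa(t_0))^{-1}(x)=\frac{\beta}{2\pi}\Big(K_0(|x|)-K_0\big(\sqrt{\kappa(t_0)}\,|x|\big)\Big),$$ extended continuously to $x=0$, where the scale function $\kappa$ is decreasing on $(-\infty,0]$ with $\kappa(-\infty)=\infty$ and $\kappa(0)=1$. For a measurable $X\subset\mathbb R^2$ with $0<|X|<\infty$ let $\Lambda=X\times\{-1,1\}$, $$\Xi_\Lambda(z)=\sum_{n\ge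 0}\frac{z^n}{n!}\int_{\Lambda^n}d^n\rho(\xi)\,\prod_{i<j}e^{-\sigma_i\sigma_jv(x_i-x_j)},\qquad b_{\Lambda,n}=\frac{1}{n!\,|X|}\int_{\Lambda^n}d^n\rho(\xi)\sum_{G}\prod_{ij\in G}\big(e^{-\sigma_i\sigma_jv(x_i-x_j)}-1\big),$$ the last sum being over the connected graphs $G$ on $\{1,\dots,n\}$; $\sum_n b_{\Lambda,n}z^n$ is the Mayer series. Then the Mayer series converges for $|z|<R_\beta$, uniformly in the cutoff $t_0$ and in the volume, with a radius that does not depend on the scale function. Precisely, there are numbers $c_n\ge 0$ that depend only on $\beta$, with $\sum_n c_nr^n<\infty$ for all $0\le r<R_\beta$, such that for every $X$ as above: 1. For every scale function $\kappa$, every cutoff $t_0\le 0$ and all $n$, the integrals above converge absolutely and $|b_{\Lambda,n}|\le c_n$; and for all complex $z$ with $|z|<R_\beta$ the Mayer series and the series $\Xi_\Lambda(z)$ converge and $\Xi_\Lambda(z)=\exp\big(|X|\sum_n b_{\Lambda,n}z^n\big)$, that is, the Mayer series is the expansion of $\beta p_\Lambda=|X|^{-1}\ln\Xi_\Lambda$.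 2. The same holds, with the same $c_n$, for the gas without cutoff. 3. For every scale function $\kappa$ and every $n$, the coefficient $b_{\Lambda,n}$ with cutoff $t_0$ tends to the one without cutoff as $t_0\to-\infty$. -/

import Mathlib

open MeasureTheory Filter Topology

noncomputable section

namespace YukawaGas

/-- Positions are points of the Euclidean plane. -/
abbrev Plane := EuclideanSpace ℝ (Fin 2)

/-- The modified Bessel function of the second kind of order zero,
`K₀(w) = ∫₀^∞ exp (-w cosh u) du`, for `w > 0`. -/
def besselKZero (w : ℝ) : ℝ :=
  ∫ u in Set.Ioi (0 : ℝ), Real.exp (-(w * Real.cosh u))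

/-- The kernel `(-Δ + m)⁻¹(x) = (2π)⁻¹ K₀(√m |x|)` of the resolvent of the Laplacian of the
plane, for `m > 0` and `x ≠ 0`. It is `+∞` at `x = 0`, where the value here is without meaning. -/
def resolventKernel (m : ℝ) (x : Plane) : ℝ :=
  1 / (2 * Real.pi) * besselKZero (Real.sqrt m * ‖x‖)

/-- The Yukawa potential without ultraviolet cutoff, times the inverse temperature:
`β (-Δ + 1)⁻¹(x)`. -/
def yukawa (β : ℝ) (x : Plane) : ℝ :=
  β * resolventKernel 1 x

/-- A scale function: decreasing on `(-∞, 0]` with `κ(-∞) = ∞` and `κ(0) = 1`. -/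
structure IsScaleFunction (κ : ℝ → ℝ) : Prop where
  antitoneOn : AntitoneOn κ (Set.Iic 0)
  tendsto_atBot : Tendsto κ atBot atTop
  map_zero : κ 0 = 1

/-- With `v(t, x) = β (-Δ + κ(t))⁻¹(x)`, the Yukawa potential with the scales below `t₀` removed:
`v(0, x) - v(t₀, x)`, which is the integral of `∂v/∂s (s, x)` over `t₀ ≤ s ≤ 0` when `κ` is
differentiable. Both terms are infinite at `x = 0`; the value there is the limit
`(β / 4π) log κ(t₀)` of the difference as `x → 0`. -/
def yukawaCutoff (β : ℝ) (κ : ℝ → ℝ) (t₀ : ℝ) (x : Plane) : ℝ :=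
  if x = 0 then β / (4 * Real.pi) * Real.log (κ t₀)
  else β * resolventKernel (κ 0) x - β * resolventKernel (κ t₀) x

/-- The interaction `σᵢ σⱼ v(xᵢ - xⱼ)` of the particles `i` and `j`, inverse temperature
included. The charges are units of `ℤ`, that is `±1`. -/
def pairInteraction (v : Plane → ℝ) {n : ℕ} (σ : Fin n → ℤˣ) (x : Fin n → Plane)
    (i j : Fin n) : ℝ :=
  ((σ i : ℤ) : ℝ) * ((σ j : ℤ) : ℝ) * v (x i - x j)

/-- The Boltzmann factor `ψₙ = exp (-∑_{i<j} σᵢ σⱼ v(xᵢ - xⱼ))`. -/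
def boltzmann (v : Plane → ℝ) {n : ℕ} (σ : Fin n → ℤˣ) (x : Fin n → Plane) : ℝ :=
  Real.exp (-∑ p : Fin n × Fin n with p.1 < p.2, pairInteraction v σ x p.1 p.2)

open Classical in
/-- The Ursell function `ψₙᶜ`: the sum over the connected graphs `G` on `n` vertices of
the product over the edges `ij` of `G` of `exp (-σᵢ σⱼ v(xᵢ - xⱼ)) - 1`. -/
def ursell (v : Plane → ℝ) {n : ℕ} (σ : Fin n → ℤˣ) (x : Fin n → Plane) : ℝ :=
  ∑ G : SimpleGraph (Fin n) with G.Connected,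
    ∏ p : Fin n × Fin n with p.1 < p.2 ∧ G.Adj p.1 p.2,
      (Real.exp (-pairInteraction v σ x p.1 p.2) - 1)

/-- The configurations of `n` positions in the region `X`. -/
def configs (X : Set Plane) (n : ℕ) : Set (Fin n → Plane) :=
  Set.univ.pi fun _ => X

/-- The integral of `F` over `n`-particle states with positions in `X`, with respect to the
`n`-fold product of Lebesgue measure times the uniform probability measure on the two charges. -/
def stateIntegral (X : Set Plane) (n : ℕ) (F : (Fin n → ℤˣ) → (Fin n → Plane) → ℝ) : ℝ :=
  (1 / 2 : ℝ) ^ n * ∑ σ : Fin n → ℤˣ, ∫ x in configs X n, F σ x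

/-- The Taylor coefficients in the activity `z` of the grand canonical partition function
`Ξ(z) = ∑ₙ (zⁿ / n!) ∫ ψₙ` in the region `X`. -/
def partitionCoeff (v : Plane → ℝ) (X : Set Plane) (n : ℕ) : ℝ :=
  1 / (n.factorial : ℝ) * stateIntegral X n (fun σ x => boltzmann v σ x)

/-- The Mayer coefficients `bₙ = (n! |X|)⁻¹ ∫ ψₙᶜ` in the region `X`. -/
def mayerCoeff (v : Plane → ℝ) (X : Set Plane) (n : ℕ) : ℝ :=
  1 / ((volume X).toReal * (n.factorial : ℝ)) * stateIntegral X n (fun σ x => ursell v σ x)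

/-- The Mayer series of the gas with potential `v` in the region `X` is majorized by
`∑ₙ cₙ zⁿ` and, for `|z| < R`, it converges absolutely to
`β p(z) = |X|⁻¹ log Ξ(z)`. All integrals that occur converge absolutely. -/
structure HasMayerSeries (v : Plane → ℝ) (X : Set Plane) (c : ℕ → ℝ) (R : ℝ) : Prop where
  integrable_boltzmann : ∀ (n : ℕ) (σ : Fin n → ℤˣ),
    IntegrableOn (fun x => boltzmann v σ x) (configs X n)
  integrable_ursell : ∀ (n : ℕ) (σ : Fin n → ℤˣ),
    IntegrableOn (fun x => ursell v σ x) (configs X n)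
  abs_coeff_le : ∀ n : ℕ, |mayerCoeff v X n| ≤ c n
  summable : ∀ z : ℂ, ‖z‖ < R → Summable fun n : ℕ => ‖(mayerCoeff v X n : ℂ) * z ^ n‖
  hasSum_partition : ∀ z : ℂ, ‖z‖ < R →
    HasSum (fun n : ℕ => (partitionCoeff v X n : ℂ) * z ^ n)
      (Complex.exp (((volume X).toReal : ℂ) * ∑' n : ℕ, (mayerCoeff v X n : ℂ) * z ^ n))

end YukawaGas

end

/-! Away from the origin the resolvent is a superposition of heat kernels, `(-Δ + m)⁻¹ = ∫ exp (-mτ)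
p_τ dτ`. With `u = 1 - exp (-τ)` as scale, `β (-Δ + m)⁻¹ = ∫₀¹ β (1 - u)^(m - 1) p_τ du`. The Yukawa
potential has weight `1` and each cutoff potential has weight `1 - (1 - u)^(κ(t₀) - 1)`. Since only
`0 ≤ g ≤ 1` is used of the weight `g`, all bounds are uniform in the scale function and the cutoff.

Switch the scales on from `u = 0`, the shortest distances, to `u = 1`. The Ursell function of a
cluster `I` obeys the flow equation `∂ψᶜ(I) = -W(I) ψᶜ(I) - ∑ W(A, B) ψᶜ(A) ψᶜ(B)`
(`hasDerivAt_connSum_insert`), where `W` is the energy of the slice at scale `u` and the sum is over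
the splittings of `I` into two clusters. The linear term goes into an integrating factor. Positive
definiteness of the Gaussian (`neg_le_pairSum_heat`) gives `W(I) ≥ -|I| β / (8πτ) ≥ -|I| β / (8πu)`,
so that running from scale `s` to `u` costs at most `(u / s)^(|I| β / 8π)`
(`exp_pairSum_pot_sub_le`). This yields the pointwise bound `majorant`, which does not depend on the
weight (`enorm_connSum_le`).

Integrate the majorant over all positions but one. A slice has integral at most `β`, so by induction
the result for `n` particles is at most `θ^(n-1) n^(n-2) u^(n-1)` (`lmarginal_majorant_le`). The
scale integral of `(u / s)^(nβ / 8π) s^(n-2)` converges for all `n ≥ 2` exactly when `β < 4π`, the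
case `n = 2` being the critical one; it also dictates `θ = 4πβ / (4π - β)`. The sum over splittings
is Abel's identity for trees (`abel_sum`). As `n^(n-2) / n! ≤ eⁿ`, the Mayer series converges for
`|z| < 1 / (eθ) = R_β`.

The identity `Ξ = exp (|X| ∑ bₙ zⁿ)` follows from expanding the Boltzmann factor by the cluster of
one particle, which is the recursion for the coefficients of an exponential
(`hasSum_exp_of_recursion`). Removing the cutoff is dominated convergence under the same majorant.
-/

namespace YukawaGas

/-! ### Connected graphs and the cluster expansion of a product over pairs. -/

section Combinatorics

variable {ι : Type*}

/-- Adjacency in the graph with edge set `T`. -/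
def EdgeRel (T : Finset (ι × ι)) (a b : ι) : Prop := (a, b) ∈ T ∨ (b, a) ∈ T

/-- Reachability in the graph with edge set `T`. -/
def Reach (T : Finset (ι × ι)) : ι → ι → Prop := Relation.ReflTransGen (EdgeRel T)

theorem EdgeRel.symm {T : Finset (ι × ι)} {a b : ι} (h : EdgeRel T a b) : EdgeRel T b a :=
  Or.symm h

theorem Reach.symm {T : Finset (ι × ι)} {a b : ι} (h : Reach T a b) : Reach T b a := by
  induction h with
  | refl => exact .refl
  | tail _ hbc ih => exact .head hbc.symm ih

theorem Reach.mono {S T : Finset (ι × ι)} (hST : S ⊆ T) {a b : ι} (h : Reach S a b) :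
    Reach T a b :=
  Relation.ReflTransGen.mono (fun _ _ h => h.imp (fun h => hST h) (fun h => hST h)) _ _ h

/-- The graph with edge set `T` connects the elements of the nonempty set `I`. -/
def ConnectedOn (T : Finset (ι × ι)) (I : Finset ι) : Prop :=
  I.Nonempty ∧ ∀ i ∈ I, ∀ j ∈ I, Reach T i j

open Classical in
/-- The vertices of `I` in the connected component of `i`. -/
noncomputable def component (T : Finset (ι × ι)) (I : Finset ι) (i : ι) : Finset ι :=
  I.filter fun j => Reach T i j

theorem mem_component {T : Finset (ι × ι)} {I : Finset ι} {i j : ι} :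
    j ∈ component T I i ↔ j ∈ I ∧ Reach T i j := by
  simp [component]

variable [LinearOrder ι]

/-- The pairs `i < j` of elements of `I`. -/
def pairs (I : Finset ι) : Finset (ι × ι) := (I ×ˢ I).filter fun p => p.1 < p.2

theorem mem_pairs {I : Finset ι} {p : ι × ι} :
    p ∈ pairs I ↔ p.1 ∈ I ∧ p.2 ∈ I ∧ p.1 < p.2 := by
  simp [pairs, and_assoc]

theorem pairs_mono {I J : Finset ι} (h : I ⊆ J) : pairs I ⊆ pairs J := by
  intro p hp
  rw [mem_pairs] at hp ⊢
  exact ⟨h hp.1, h hp.2.1, hp.2.2⟩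

variable {R : Type*} [CommRing R]

/-- The product of `1 + f i j` over the pairs of `I`. -/
def pairProd (f : ι → ι → R) (I : Finset ι) : R := ∏ p ∈ pairs I, (1 + f p.1 p.2)

open Classical in
/-- The sum over connected graphs on `I` of the products of the weights of the edges. -/
noncomputable def connSum (f : ι → ι → R) (I : Finset ι) : R :=
  ∑ T ∈ (pairs I).powerset with ConnectedOn T I, ∏ p ∈ T, f p.1 p.2

@[simp] theorem pairProd_empty (f : ι → ι → R) : pairProd f ∅ = 1 := by
  simp [pairProd, pairs]

theorem connSum_empty (f : ι → ι → R) : connSum f ∅ = 0 := by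
  simp [connSum, ConnectedOn]

theorem pairProd_eq_sum (f : ι → ι → R) (I : Finset ι) :
    pairProd f I = ∑ T ∈ (pairs I).powerset, ∏ p ∈ T, f p.1 p.2 :=
  Finset.prod_one_add _

theorem disjoint_pairs {I J : Finset ι} (h : Disjoint I J) : Disjoint (pairs I) (pairs J) := by
  rw [Finset.disjoint_left]
  intro p hp hq
  rw [mem_pairs] at hp hq
  exact Finset.disjoint_left.1 h hp.1 hq.1

/-- A path from `i` never leaves the component of `i`, so it only uses edges inside it. -/
theorem reach_of_component {T : Finset (ι × ι)} {I : Finset ι} {i : ι} (hT : T ⊆ pairs I)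
    (hi : i ∈ I) {j : ι} (h : Reach T i j) :
    j ∈ I ∧ Reach (T ∩ pairs (component T I i)) i j := by
  induction h with
  | refl => exact ⟨hi, .refl⟩
  | @tail b c hb hbc ih =>
    have hcI : c ∈ I := by
      rcases hbc with h | h
      · exact (mem_pairs.1 (hT h)).2.1
      · exact (mem_pairs.1 (hT h)).1
    have hb' : b ∈ component T I i := mem_component.2 ⟨ih.1, hb⟩
    have hc' : c ∈ component T I i := mem_component.2 ⟨hcI, hb.tail hbc⟩
    refine ⟨hcI, ih.2.tail ?_⟩
    rcases hbc with h | h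
    · exact Or.inl (Finset.mem_inter.2 ⟨h, mem_pairs.2 ⟨hb', hc', (mem_pairs.1 (hT h)).2.2⟩⟩)
    · exact Or.inr (Finset.mem_inter.2 ⟨h, mem_pairs.2 ⟨hc', hb', (mem_pairs.1 (hT h)).2.2⟩⟩)

theorem connectedOn_component {T : Finset (ι × ι)} {I : Finset ι} {i : ι} (hT : T ⊆ pairs I)
    (hi : i ∈ I) : ConnectedOn (T ∩ pairs (component T I i)) (component T I i) := by
  refine ⟨⟨i, mem_component.2 ⟨hi, .refl⟩⟩, fun a ha b hb => ?_⟩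
  have h1 := (reach_of_component hT hi (mem_component.1 ha).2).2
  have h2 := (reach_of_component hT hi (mem_component.1 hb).2).2
  exact Relation.ReflTransGen.trans h1.symm h2

theorem subset_pairs_component {T : Finset (ι × ι)} {I : Finset ι} {i : ι} (hT : T ⊆ pairs I) :
    T ⊆ pairs (component T I i) ∪ pairs (I \ component T I i) := by
  intro p hp
  obtain ⟨h1, h2, h3⟩ := mem_pairs.1 (hT hp)
  have key : p.1 ∈ component T I i ↔ p.2 ∈ component T I i := by
    simp only [mem_component, h1, h2, true_and]
    exact ⟨fun h => h.tail (Or.inl hp), fun h => h.tail (Or.inr hp)⟩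
  by_cases h : p.1 ∈ component T I i
  · exact Finset.mem_union_left _ (mem_pairs.2 ⟨h, key.1 h, h3⟩)
  · exact Finset.mem_union_right _ (mem_pairs.2
      ⟨Finset.mem_sdiff.2 ⟨h1, h⟩, Finset.mem_sdiff.2 ⟨h2, fun h' => h (key.2 h')⟩, h3⟩)

theorem component_union {I J : Finset ι} {i : ι} (hJ : J ⊆ I) (hi : i ∈ J)
    {S T : Finset (ι × ι)} (hS : S ⊆ pairs J) (hSc : ConnectedOn S J) (hT : T ⊆ pairs (I \ J)) :
    component (S ∪ T) I i = J := by
  ext j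
  rw [mem_component]
  constructor
  · rintro ⟨-, h⟩
    induction h with
    | refl => exact hi
    | @tail b c _ hbc ih =>
      rcases hbc with h | h <;> rcases Finset.mem_union.1 h with h | h
      · exact (mem_pairs.1 (hS h)).2.1
      · exact absurd ih (Finset.mem_sdiff.1 (mem_pairs.1 (hT h)).1).2
      · exact (mem_pairs.1 (hS h)).1
      · exact absurd ih (Finset.mem_sdiff.1 (mem_pairs.1 (hT h)).2.1).2
  · intro hj
    exact ⟨hJ hj, (hSc.2 i hi j hj).mono Finset.subset_union_left⟩

/-- Expansion of the product over all pairs by the component of a vertex. -/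
theorem pairProd_eq_sum_component (f : ι → ι → R) {I : Finset ι} {i : ι} (hi : i ∈ I) :
    pairProd f I = ∑ J ∈ I.powerset with i ∈ J, connSum f J * pairProd f (I \ J) := by
  classical
  rw [pairProd_eq_sum, ← Finset.sum_fiberwise_of_maps_to
    (g := fun T => component T I i) (t := I.powerset.filter fun J => i ∈ J)]
  · refine Finset.sum_congr rfl fun J hJ => ?_
    obtain ⟨hJI, hiJ⟩ : J ⊆ I ∧ i ∈ J := by simpa using hJ
    rw [connSum, pairProd_eq_sum, Finset.sum_mul_sum, ← Finset.sum_product']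
    -- A graph in which `i` has component `J` is a connected graph on `J` together with an arbitrary
    -- graph on the complement.
    refine Finset.sum_bij' (fun T _ => (T ∩ pairs J, T ∩ pairs (I \ J)))
      (fun S _ => S.1 ∪ S.2) ?_ ?_ ?_ ?_ ?_
    · intro T hT
      obtain ⟨hT', rfl⟩ : T ⊆ pairs I ∧ component T I i = J := by simpa using hT
      simp only [Finset.mem_product, Finset.mem_filter, Finset.mem_powerset]
      exact ⟨⟨Finset.inter_subset_right, connectedOn_component hT' hi⟩, Finset.inter_subset_right⟩
    · intro S hS
      simp only [Finset.mem_product, Finset.mem_filter, Finset.mem_powerset] at hS ⊢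
      exact ⟨Finset.union_subset (hS.1.1.trans (pairs_mono hJI))
        (hS.2.trans (pairs_mono Finset.sdiff_subset)),
        component_union hJI hiJ hS.1.1 hS.1.2 hS.2⟩
    · intro T hT
      obtain ⟨hT', rfl⟩ : T ⊆ pairs I ∧ component T I i = J := by simpa using hT
      simp only
      rw [← Finset.inter_union_distrib_left]
      exact Finset.inter_eq_left.2 (subset_pairs_component hT')
    · intro S hS
      simp only [Finset.mem_product, Finset.mem_filter, Finset.mem_powerset] at hS ⊢
      have hd : Disjoint (pairs J) (pairs (I \ J)) := disjoint_pairs Finset.disjoint_sdiff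
      have h1 : S.2 ∩ pairs J = ∅ :=
        Finset.disjoint_iff_inter_eq_empty.1 (Finset.disjoint_of_subset_left hS.2 hd.symm)
      have h2 : S.1 ∩ pairs (I \ J) = ∅ :=
        Finset.disjoint_iff_inter_eq_empty.1 (Finset.disjoint_of_subset_left hS.1.1 hd)
      ext1
      · simp [Finset.union_inter_distrib_right, h1, Finset.inter_eq_left.2 hS.1.1]
      · simp [Finset.union_inter_distrib_right, h2, Finset.inter_eq_left.2 hS.2]
    · intro T hT
      obtain ⟨hT', rfl⟩ : T ⊆ pairs I ∧ component T I i = J := by simpa using hT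
      simp only
      rw [← Finset.prod_union, ← Finset.inter_union_distrib_left,
        Finset.inter_eq_left.2 (subset_pairs_component hT')]
      exact Finset.disjoint_of_subset_left Finset.inter_subset_right
        (Finset.disjoint_of_subset_right Finset.inter_subset_right
          (disjoint_pairs Finset.disjoint_sdiff))
  · intro T hT
    simp only [Finset.mem_filter, Finset.mem_powerset]
    exact ⟨fun j hj => (mem_component.1 hj).1, mem_component.2 ⟨hi, .refl⟩⟩

theorem sum_powerset_insert_mem {M : Type*} [AddCommMonoid M] {K : Finset ι} {i : ι} (hi : i ∉ K)
    (g : Finset ι → M) :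
    ∑ J ∈ (insert i K).powerset with i ∈ J, g J = ∑ J ∈ K.powerset, g (insert i J) := by
  refine (Finset.sum_bij' (fun J _ => insert i J) (fun J _ => J.erase i) ?_ ?_ ?_ ?_ ?_).symm
  · intro J hJ
    simpa using Finset.insert_subset_insert i (Finset.mem_powerset.1 hJ)
  · intro J hJ
    simp only [Finset.mem_filter, Finset.mem_powerset] at hJ ⊢
    exact Finset.subset_insert_iff.1 hJ.1
  · intro J hJ
    exact Finset.erase_insert fun h => hi (Finset.mem_powerset.1 hJ h)
  · intro J hJ
    exact Finset.insert_erase (Finset.mem_filter.1 hJ).2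
  · intro J hJ
    rfl

theorem insert_sdiff_insert_of_notMem {K J : Finset ι} {i : ι} (hi : i ∉ K) :
    insert i K \ insert i J = K \ J := by
  ext j
  simp only [Finset.mem_sdiff, Finset.mem_insert, not_or]
  constructor
  · rintro ⟨rfl | h, h1, h2⟩
    · exact absurd rfl h1
    · exact ⟨h, h2⟩
  · rintro ⟨h1, h2⟩
    exact ⟨Or.inr h1, fun h => hi (h ▸ h1), h2⟩

theorem pairProd_insert (f : ι → ι → R) {K : Finset ι} {i : ι} (hi : i ∉ K) :
    pairProd f (insert i K) =
      ∑ J ∈ K.powerset, connSum f (insert i J) * pairProd f (K \ J) := by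
  rw [pairProd_eq_sum_component f (Finset.mem_insert_self i K), sum_powerset_insert_mem hi]
  exact Finset.sum_congr rfl fun J _ => by rw [insert_sdiff_insert_of_notMem hi]

/-- Solving the component expansion for its term `J = K` gives a recursion that determines `connSum`
from `pairProd`. Later facts about `connSum` are inductions on it and do not look at graphs. -/
theorem connSum_insert (f : ι → ι → R) {K : Finset ι} {i : ι} (hi : i ∉ K) :
    connSum f (insert i K) = pairProd f (insert i K) -
      ∑ J ∈ K.ssubsets, connSum f (insert i J) * pairProd f (K \ J) := by
  rw [pairProd_insert f hi, Finset.ssubsets,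
    ← Finset.add_sum_erase _ _ (Finset.mem_powerset_self K)]
  simp

theorem connSum_singleton (f : ι → ι → R) (i : ι) : connSum f {i} = 1 := by
  have := connSum_insert f (Finset.notMem_empty i)
  simpa [pairProd, pairs, Finset.ssubsets, Finset.filter_singleton] using this

theorem connSum_zero {I : Finset ι} (hI : 1 < I.card) : connSum (0 : ι → ι → R) I = 0 := by
  classical
  refine Finset.sum_eq_zero fun T hT => ?_
  obtain ⟨p, hp⟩ : T.Nonempty := by
    rw [Finset.nonempty_iff_ne_empty]
    rintro rfl
    obtain ⟨a, ha, b, hb, hab⟩ := Finset.one_lt_card.1 hI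
    have := (Finset.mem_filter.1 hT).2.2 a ha b hb
    rcases Relation.ReflTransGen.cases_head this with h | ⟨c, h, -⟩
    · exact hab h
    · simp [EdgeRel] at h
  exact Finset.prod_eq_zero hp (by simp)

theorem pairs_map {κ : Type*} [LinearOrder κ] (e : κ ↪o ι) (J : Finset κ) :
    pairs (J.map e.toEmbedding) = (pairs J).map (e.toEmbedding.prodMap e.toEmbedding) := by
  ext ⟨a, b⟩
  simp only [mem_pairs, Finset.mem_map, Prod.exists, Function.Embedding.coe_prodMap, Prod.map_apply,
    Prod.mk.injEq]
  constructor
  · rintro ⟨⟨a, ha, rfl⟩, ⟨b, hb, rfl⟩, h⟩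
    exact ⟨a, b, ⟨ha, hb, by simpa using h⟩, rfl, rfl⟩
  · rintro ⟨a, b, ⟨ha, hb, h⟩, rfl, rfl⟩
    exact ⟨⟨a, ha, rfl⟩, ⟨b, hb, rfl⟩, by simpa using h⟩

theorem pairProd_map {κ : Type*} [LinearOrder κ] (e : κ ↪o ι) (f : ι → ι → R) (J : Finset κ) :
    pairProd f (J.map e.toEmbedding) = pairProd (fun a b => f (e a) (e b)) J := by
  simp [pairProd, pairs_map]

/-- Both sides satisfy the same recursion, because `pairProd` is invariant under relabelling. -/
theorem connSum_map {κ : Type*} [LinearOrder κ] (e : κ ↪o ι) (f : ι → ι → R) (J : Finset κ) :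
    connSum f (J.map e.toEmbedding) = connSum (fun a b => f (e a) (e b)) J := by
  induction J using Finset.strongInduction with
  | H J ih =>
    rcases J.eq_empty_or_nonempty with rfl | ⟨i, hi⟩
    · simp [connSum_empty]
    · obtain ⟨K, hiK, rfl⟩ : ∃ K, i ∉ K ∧ J = insert i K :=
        ⟨J.erase i, Finset.notMem_erase i J, (Finset.insert_erase hi).symm⟩
      have hmap : ∀ L : Finset κ, (insert i L).map e.toEmbedding
          = insert (e i) (L.map e.toEmbedding) := fun L => by simp [Finset.map_insert]
      have hei : e i ∉ K.map e.toEmbedding := by simpa using hiK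
      have h1 := pairProd_insert f hei
      have h2 := pairProd_insert (fun a b => f (e a) (e b)) hiK
      rw [← hmap, pairProd_map, h2, Finset.map_eq_image, Finset.powerset_image,
        Finset.sum_image (Finset.image_injective e.toEmbedding.injective).injOn] at h1
      rw [← Finset.add_sum_erase _ _ (Finset.mem_powerset_self K),
        ← Finset.add_sum_erase _ _ (Finset.mem_powerset_self K)] at h1
      simp only [sdiff_self, Finset.bot_eq_empty, pairProd_empty, mul_one] at h1
      rw [hmap, Finset.map_eq_image, ← add_left_inj, ← h1]
      congr 1
      refine Finset.sum_congr rfl fun L hL => ?_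
      have hLK : L ⊂ K := Finset.mem_ssubsets.1 hL
      rw [← Finset.image_sdiff _ _ e.toEmbedding.injective, ← Finset.map_eq_image, ← Finset.map_eq_image,
        pairProd_map, ← hmap, ih]
      refine ⟨Finset.insert_subset_insert i hLK.1, fun h => hLK.2 fun j hj => ?_⟩
      rcases Finset.mem_insert.1 (h (Finset.mem_insert_of_mem hj)) with rfl | h
      · exact absurd hj hiK
      · exact h

end Combinatorics

/-! ### Boltzmann factors and Ursell functions as pair products and connected sums. -/

section Frozen

theorem boltzmann_eq (v : Plane → ℝ) {n : ℕ} (σ : Fin n → ℤˣ) (x : Fin n → Plane) :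
    boltzmann v σ x =
      pairProd (fun i j => Real.exp (-pairInteraction v σ x i j) - 1) Finset.univ := by
  rw [boltzmann, ← Finset.sum_neg_distrib, Real.exp_sum, pairProd]
  refine Finset.prod_congr (by ext; simp [mem_pairs]) fun p _ => by ring

/-- A simple graph corresponds to the set of its edges, each written as an ordered pair `i < j`;
connectedness is the same notion on both sides. -/
theorem ursell_eq (v : Plane → ℝ) {n : ℕ} (σ : Fin n → ℤˣ) (x : Fin n → Plane) :
    ursell v σ x =
      connSum (fun i j => Real.exp (-pairInteraction v σ x i j) - 1) Finset.univ := by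
  classical
  obtain ⟨E, hE⟩ : ∃ E : SimpleGraph (Fin n) → Finset (Fin n × Fin n),
      ∀ G p, p ∈ E G ↔ p.1 < p.2 ∧ G.Adj p.1 p.2 :=
    ⟨fun G => Finset.univ.filter fun p => p.1 < p.2 ∧ G.Adj p.1 p.2, by simp⟩
  have hreach : ∀ (G : SimpleGraph (Fin n)) (a b : Fin n),
      Reach (E G) a b ↔
        G.Reachable a b := by
    intro G a b
    rw [SimpleGraph.reachable_iff_reflTransGen, Reach]
    have : EdgeRel (E G)
        = G.Adj := by
      ext a b
      simp only [EdgeRel, hE]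
      constructor
      · rintro (h | h)
        · exact h.2
        · exact h.2.symm
      · intro h
        rcases lt_or_gt_of_ne h.ne with h' | h'
        · exact Or.inl ⟨h', h⟩
        · exact Or.inr ⟨h', h.symm⟩
    rw [this]
  have hconn : ∀ G : SimpleGraph (Fin n), G.Connected ↔
      ConnectedOn (E G)
        Finset.univ := by
    intro G
    rw [SimpleGraph.connected_iff, ConnectedOn]
    simp only [hreach, Finset.mem_univ, true_imp_iff, SimpleGraph.Preconnected,
      Finset.univ_nonempty_iff]
    exact and_comm
  have hinv : ∀ T ⊆ pairs (Finset.univ : Finset (Fin n)),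
      E (SimpleGraph.fromRel fun a b => (a, b) ∈ T) = T := by
    intro T hT
    ext ⟨a, b⟩
    simp only [hE, SimpleGraph.fromRel_adj]
    constructor
    · rintro ⟨h1, -, h2 | h2⟩
      · exact h2
      · exact absurd (mem_pairs.1 (hT h2)).2.2 h1.not_gt
    · intro h
      have := (mem_pairs.1 (hT h)).2.2
      exact ⟨this, this.ne, Or.inl h⟩
  rw [ursell, connSum]
  refine Finset.sum_bij'
    (fun G _ => E G)
    (fun T _ => SimpleGraph.fromRel fun a b => (a, b) ∈ T) ?_ ?_ ?_ ?_ ?_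
  · intro G hG
    simp only [Finset.mem_filter, Finset.mem_univ, true_and, Finset.mem_powerset] at hG ⊢
    exact ⟨fun p hp => mem_pairs.2 ⟨Finset.mem_univ _, Finset.mem_univ _,
      ((hE _ _).1 hp).1⟩, (hconn G).1 hG⟩
  · intro T hT
    simp only [Finset.mem_filter, Finset.mem_univ, true_and, Finset.mem_powerset] at hT ⊢
    rw [hconn, hinv T hT.1]
    exact hT.2
  · intro G hG
    ext a b
    simp only [SimpleGraph.fromRel_adj, hE]
    constructor
    · rintro ⟨-, h | h⟩
      · exact h.2
      · exact h.2.symm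
    · intro h
      refine ⟨h.ne, ?_⟩
      rcases lt_or_gt_of_ne h.ne with h' | h'
      · exact Or.inl ⟨h', h⟩
      · exact Or.inr ⟨h', h.symm⟩
  · intro T hT
    simp only [Finset.mem_filter, Finset.mem_powerset] at hT
    exact hinv T hT.1
  · intro G _
    exact Finset.prod_congr (by ext; simp [hE]) fun _ _ => rfl

end Frozen

/-! ### The flow equation of the Ursell functions under a change of the potential. -/

section Flow

variable {ι : Type*} [LinearOrder ι]

/-- The sum of `w i j` over the pairs of `I`. -/
def pairSum {R : Type*} [AddCommMonoid R] (w : ι → ι → R) (I : Finset ι) : R :=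
  ∑ p ∈ pairs I, w p.1 p.2

theorem pairSum_eq {R : Type*} [AddCommMonoid R] (w : ι → ι → R) (I : Finset ι) :
    pairSum w I = ∑ i ∈ I, ∑ j ∈ I, if i < j then w i j else 0 := by
  rw [pairSum, pairs, Finset.sum_filter, Finset.sum_product]

theorem pairSum_union {R : Type*} [AddCommMonoid R] {w : ι → ι → R} (hw : ∀ i j, w i j = w j i)
    {A B : Finset ι} (hAB : Disjoint A B) :
    pairSum w (A ∪ B) = pairSum w A + pairSum w B + ∑ i ∈ A, ∑ j ∈ B, w i j := by
  have hcross : ∑ i ∈ A, ∑ j ∈ B, w i j = (∑ i ∈ A, ∑ j ∈ B, if i < j then w i j else 0) +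
      ∑ i ∈ B, ∑ j ∈ A, if i < j then w i j else 0 := by
    rw [Finset.sum_comm (s := B), ← Finset.sum_add_distrib]
    refine Finset.sum_congr rfl fun i hi => ?_
    rw [← Finset.sum_add_distrib]
    refine Finset.sum_congr rfl fun j hj => ?_
    have hij : i ≠ j := fun h => Finset.disjoint_left.1 hAB hi (h ▸ hj)
    rcases lt_or_gt_of_ne hij with h | h
    · simp [h, h.not_gt]
    · simp [h, h.not_gt, hw i j]
  rw [pairSum_eq, pairSum_eq, pairSum_eq, Finset.sum_union hAB, hcross]
  simp_rw [Finset.sum_union hAB, Finset.sum_add_distrib]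
  abel

/-- For each `j` the terms with `j ∈ B` are the expansion of `pairProd f L` by the component of `j`.
-/
theorem sum_mul_connSum_mul_pairProd {R : Type*} [CommRing R] (f : ι → ι → R) (c : ι → R)
    (L : Finset ι) :
    ∑ B ∈ L.powerset, (∑ j ∈ B, c j) * (connSum f B * pairProd f (L \ B)) =
      (∑ j ∈ L, c j) * pairProd f L := by
  have h : ∀ B ∈ L.powerset, (∑ j ∈ B, c j) * (connSum f B * pairProd f (L \ B)) =
      ∑ j ∈ L, if j ∈ B then c j * (connSum f B * pairProd f (L \ B)) else 0 := by
    intro B hB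
    rw [← Finset.sum_filter, Finset.sum_mul]
    refine Finset.sum_congr ?_ fun _ _ => rfl
    ext j
    simpa using fun hj => Finset.mem_powerset.1 hB hj
  rw [Finset.sum_congr rfl h, Finset.sum_comm, Finset.sum_mul]
  refine Finset.sum_congr rfl fun j hj => ?_
  rw [pairProd_eq_sum_component f hj, Finset.mul_sum, Finset.sum_filter]

theorem sum_powerset_powerset {M : Type*} [AddCommMonoid M] (K : Finset ι)
    (g : Finset ι → Finset ι → M) :
    ∑ J ∈ K.powerset, ∑ A ∈ J.powerset, g A (J \ A) =
      ∑ A ∈ K.powerset, ∑ B ∈ (K \ A).powerset, g A B := by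
  rw [Finset.sum_sigma', Finset.sum_sigma']
  refine Finset.sum_bij' (fun p _ => ⟨p.2, p.1 \ p.2⟩) (fun p _ => ⟨p.1 ∪ p.2, p.1⟩) ?_ ?_ ?_ ?_ ?_
  · rintro ⟨J, A⟩ h
    simp only [Finset.mem_sigma, Finset.mem_powerset] at h ⊢
    exact ⟨h.2.trans h.1, Finset.sdiff_subset_sdiff h.1 le_rfl⟩
  · rintro ⟨A, B⟩ h
    simp only [Finset.mem_sigma, Finset.mem_powerset] at h ⊢
    exact ⟨Finset.union_subset h.1 (h.2.trans Finset.sdiff_subset), Finset.subset_union_left⟩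
  · rintro ⟨J, A⟩ h
    simp only [Finset.mem_sigma, Finset.mem_powerset] at h
    simp [Finset.union_sdiff_of_subset h.2]
  · rintro ⟨A, B⟩ h
    simp only [Finset.mem_sigma, Finset.mem_powerset] at h
    have : Disjoint B A := Finset.disjoint_of_subset_left h.2 Finset.sdiff_disjoint
    simp [Finset.union_sdiff_left, Finset.sdiff_eq_self_of_disjoint this]
  · rintro ⟨J, A⟩ h
    rfl

/-- The right-hand side of the flow equation of `connSum`. -/
noncomputable def flowRHS (f w : ι → ι → ℝ) (i : ι) (K : Finset ι) : ℝ :=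
  -(pairSum w (insert i K) * connSum f (insert i K)) -
    ∑ A ∈ K.powerset, (∑ a ∈ insert i A, ∑ b ∈ K \ A, w a b) *
      (connSum f (insert i A) * connSum f (K \ A))

/-- This is the derivative of `pairProd_insert` with `flowRHS` in place of the derivative of
`connSum`. The energy of the whole set splits into the energies of the two blocks and the energy
across; the latter is what the quadratic term of `flowRHS` sums up to. -/
theorem sum_flowRHS (f : ι → ι → ℝ) {w : ι → ι → ℝ} (hw : ∀ i j, w i j = w j i) {i : ι}
    {K : Finset ι} (hi : i ∉ K) :
    -(pairSum w (insert i K) * pairProd f (insert i K)) =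
      ∑ J ∈ K.powerset, (flowRHS f w i J * pairProd f (K \ J) +
        connSum f (insert i J) * (-(pairSum w (K \ J) * pairProd f (K \ J)))) := by
  have h1 : ∑ J ∈ K.powerset, (∑ A ∈ J.powerset, (∑ a ∈ insert i A, ∑ b ∈ J \ A, w a b) *
      (connSum f (insert i A) * connSum f (J \ A))) * pairProd f (K \ J) =
      ∑ J ∈ K.powerset, (∑ a ∈ insert i J, ∑ b ∈ K \ J, w a b) *
        (connSum f (insert i J) * pairProd f (K \ J)) := by
    have h2 : ∀ J ∈ K.powerset, (∑ A ∈ J.powerset, (∑ a ∈ insert i A, ∑ b ∈ J \ A, w a b) *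
        (connSum f (insert i A) * connSum f (J \ A))) * pairProd f (K \ J) =
        ∑ A ∈ J.powerset, (∑ a ∈ insert i A, ∑ b ∈ J \ A, w a b) *
        (connSum f (insert i A) * connSum f (J \ A)) * pairProd f ((K \ A) \ (J \ A)) := by
      intro J hJ
      rw [Finset.sum_mul]
      refine Finset.sum_congr rfl fun A hA => ?_
      congr 2
      ext j
      have hAj : j ∈ A → j ∈ J := fun h => Finset.mem_powerset.1 hA h
      simp only [Finset.mem_sdiff]
      tauto
    rw [Finset.sum_congr rfl h2, sum_powerset_powerset K fun A B =>
      (∑ a ∈ insert i A, ∑ b ∈ B, w a b) * (connSum f (insert i A) * connSum f B) *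
        pairProd f ((K \ A) \ B)]
    refine Finset.sum_congr rfl fun A _ => ?_
    -- For fixed `A`, the sum over the second cluster `B` recombines to the full product over `K \
    -- A`.
    have h3 := sum_mul_connSum_mul_pairProd f (fun b => ∑ a ∈ insert i A, w a b) (K \ A)
    rw [Finset.sum_comm, mul_left_comm, ← h3, Finset.mul_sum]
    refine Finset.sum_congr rfl fun B _ => ?_
    rw [Finset.sum_comm]
    ring
  have h4 : ∀ J ∈ K.powerset, flowRHS f w i J * pairProd f (K \ J) +
        connSum f (insert i J) * (-(pairSum w (K \ J) * pairProd f (K \ J))) =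
      -(pairSum w (insert i K) * (connSum f (insert i J) * pairProd f (K \ J))) +
      ((∑ a ∈ insert i J, ∑ b ∈ K \ J, w a b) * (connSum f (insert i J) * pairProd f (K \ J))
        - (∑ A ∈ J.powerset, (∑ a ∈ insert i A, ∑ b ∈ J \ A, w a b) *
      (connSum f (insert i A) * connSum f (J \ A))) * pairProd f (K \ J)) := by
    intro J hJ
    have hJK := Finset.mem_powerset.1 hJ
    have hd : Disjoint (insert i J) (K \ J) := by
      rw [Finset.disjoint_insert_left]
      exact ⟨fun h => hi (Finset.mem_sdiff.1 h).1, Finset.disjoint_sdiff⟩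
    have h5 := pairSum_union hw hd
    rw [Finset.insert_union, Finset.union_sdiff_of_subset hJK] at h5
    rw [h5, flowRHS]
    ring
  rw [Finset.sum_congr rfl h4, Finset.sum_add_distrib, Finset.sum_sub_distrib, h1, sub_self,
    add_zero, Finset.sum_neg_distrib, ← Finset.mul_sum, ← pairProd_insert f hi]

variable {V : ℝ → ι → ι → ℝ} {w : ι → ι → ℝ} {u : ℝ}

theorem pairProd_exp (V : ι → ι → ℝ) (I : Finset ι) :
    pairProd (fun i j => Real.exp (-V i j) - 1) I = Real.exp (-pairSum V I) := by
  rw [pairProd, pairSum, ← Finset.sum_neg_distrib, Real.exp_sum]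
  exact Finset.prod_congr rfl fun p _ => by ring

theorem hasDerivAt_pairSum (I : Finset ι)
    (hV : ∀ p ∈ pairs I, HasDerivAt (fun s => V s p.1 p.2) (w p.1 p.2) u) :
    HasDerivAt (fun s => pairSum (V s) I) (pairSum w I) u :=
  HasDerivAt.fun_sum hV

theorem hasDerivAt_pairProd (I : Finset ι)
    (hV : ∀ p ∈ pairs I, HasDerivAt (fun s => V s p.1 p.2) (w p.1 p.2) u) :
    HasDerivAt (fun s => pairProd (fun i j => Real.exp (-V s i j) - 1) I)
      (-(pairSum w I * pairProd (fun i j => Real.exp (-V u i j) - 1) I)) u := by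
  simp_rw [pairProd_exp]
  refine (hasDerivAt_pairSum I hV).neg.exp.congr_deriv ?_
  simp only [Pi.neg_apply]
  ring

/-- Differentiate the recursion `connSum_insert`. The derivatives for proper subsets are known by
induction, and `sum_flowRHS` says that what remains is `flowRHS`. -/
theorem hasDerivAt_connSum_insert (hw : ∀ i j, w i j = w j i) {i : ι} {K : Finset ι} (hi : i ∉ K)
    (hV : ∀ p ∈ pairs (insert i K), HasDerivAt (fun s => V s p.1 p.2) (w p.1 p.2) u) :
    HasDerivAt (fun s => connSum (fun i j => Real.exp (-V s i j) - 1) (insert i K))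
      (flowRHS (fun i j => Real.exp (-V u i j) - 1) w i K) u := by
  induction K using Finset.strongInduction with
  | H K ih =>
    have hder : ∀ J ∈ K.ssubsets, HasDerivAt (fun s =>
        connSum (fun i j => Real.exp (-V s i j) - 1) (insert i J) *
          pairProd (fun i j => Real.exp (-V s i j) - 1) (K \ J))
        (flowRHS (fun i j => Real.exp (-V u i j) - 1) w i J *
          pairProd (fun i j => Real.exp (-V u i j) - 1) (K \ J) +
          connSum (fun i j => Real.exp (-V u i j) - 1) (insert i J) *
          (-(pairSum w (K \ J) * pairProd (fun i j => Real.exp (-V u i j) - 1) (K \ J)))) u := by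
      intro J hJ
      have hJK : J ⊂ K := Finset.mem_ssubsets.1 hJ
      exact (ih J hJK (fun h => hi (hJK.1 h)) fun p hp =>
        hV p (pairs_mono (Finset.insert_subset_insert i hJK.1) hp)).mul
        (hasDerivAt_pairProd _ fun p hp =>
          hV p (pairs_mono (Finset.sdiff_subset.trans (Finset.subset_insert i K)) hp))
    have h := (hasDerivAt_pairProd _ hV).sub (HasDerivAt.fun_sum hder)
    have hfun : (fun s => connSum (fun i j => Real.exp (-V s i j) - 1) (insert i K)) =
        (fun s => pairProd (fun i j => Real.exp (-V s i j) - 1) (insert i K)) -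
        fun s => ∑ J ∈ K.ssubsets, connSum (fun i j => Real.exp (-V s i j) - 1) (insert i J) *
          pairProd (fun i j => Real.exp (-V s i j) - 1) (K \ J) := by
      ext s
      exact connSum_insert _ hi
    rw [hfun]
    refine h.congr_deriv ?_
    rw [sum_flowRHS _ hw hi, Finset.ssubsets,
      ← Finset.add_sum_erase _ _ (Finset.mem_powerset_self K)]
    simp [pairSum, pairs]

/-- The flow equation of `connSum` with the integrating factor. -/
theorem hasDerivAt_exp_mul_connSum (hw : ∀ i j, w i j = w j i) {i : ι} {K : Finset ι}
    (hi : i ∉ K)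
    (hV : ∀ p ∈ pairs (insert i K), HasDerivAt (fun s => V s p.1 p.2) (w p.1 p.2) u) :
    HasDerivAt (fun s => Real.exp (pairSum (V s) (insert i K)) *
        connSum (fun i j => Real.exp (-V s i j) - 1) (insert i K))
      (-(Real.exp (pairSum (V u) (insert i K)) *
        ∑ A ∈ K.powerset, (∑ a ∈ insert i A, ∑ b ∈ K \ A, w a b) *
          (connSum (fun i j => Real.exp (-V u i j) - 1) (insert i A) *
            connSum (fun i j => Real.exp (-V u i j) - 1) (K \ A)))) u := by
  refine ((hasDerivAt_pairSum _ hV).exp.mul (hasDerivAt_connSum_insert hw hi hV)).congr_deriv ?_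
  simp only [flowRHS]
  ring

theorem continuousOn_connSum {S : Set ℝ} (I : Finset ι)
    (hV : ∀ p ∈ pairs I, ContinuousOn (fun s => V s p.1 p.2) S) :
    ContinuousOn (fun s => connSum (fun i j => Real.exp (-V s i j) - 1) I) S := by
  classical
  refine continuousOn_finsetSum _ fun T hT => continuousOn_finsetProd _ fun p hp => ?_
  have : p ∈ pairs I := Finset.mem_powerset.1 (Finset.mem_filter.1 hT).1 hp
  exact ((hV p this).neg.rexp).sub continuousOn_const

end Flow

/-! ### Positive definiteness and stability of the heat kernel. -/

section Gaussian

/-- The Gaussian is the characteristic function of the standard Gaussian measure, so the quadratic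
form is the mean of `|∑ sᵢ exp (i⟨w, yᵢ⟩)|²`. -/
theorem sum_mul_exp_neg_norm_sq_nonneg {ι E : Type*} [NormedAddCommGroup E]
    [InnerProductSpace ℝ E] [FiniteDimensional ℝ E] (I : Finset ι) (s : ι → ℝ) (y : ι → E) :
    0 ≤ ∑ i ∈ I, ∑ j ∈ I, s i * s j * Real.exp (-(‖y i - y j‖ ^ 2 / 2)) := by
  borelize E
  let μ := ProbabilityTheory.stdGaussian E
  have hcos : ∀ z : E, Real.exp (-(‖z‖ ^ 2 / 2)) = ∫ w, Real.cos (inner ℝ w z) ∂μ := by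
    intro z
    have h1 := ProbabilityTheory.charFun_stdGaussian z
    rw [charFun_apply] at h1
    have h2 := congrArg Complex.re h1
    have hint : Integrable (fun w : E => Complex.exp ((inner ℝ w z : ℝ) * Complex.I)) μ := by
      refine (integrable_const (1 : ℝ)).mono' (by fun_prop) (Eventually.of_forall fun w => ?_)
      rw [Complex.norm_exp_ofReal_mul_I]
    have h3 : (∫ w, Complex.exp ((inner ℝ w z : ℝ) * Complex.I) ∂μ).re =
        ∫ w, Real.cos (inner ℝ w z) ∂μ := by
      rw [← RCLike.re_eq_complex_re, ← integral_re hint]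
      refine integral_congr_ae (Eventually.of_forall fun w => ?_)
      simp [Complex.exp_ofReal_mul_I_re]
    rw [← h3, h2]
    have : (-(‖z‖ : ℂ) ^ 2 / 2) = ((-(‖z‖ ^ 2 / 2) : ℝ) : ℂ) := by
      push_cast; ring
    rw [this, Complex.exp_ofReal_re]
  have hci : ∀ z : E, Integrable (fun w : E => Real.cos (inner ℝ w z)) μ := by
    intro z
    refine (integrable_const (1 : ℝ)).mono' (by fun_prop) (Eventually.of_forall fun w => ?_)
    exact Real.abs_cos_le_one _
  simp_rw [hcos, ← integral_const_mul]
  have h4 : ∑ i ∈ I, ∑ j ∈ I, ∫ w, s i * s j * Real.cos (inner ℝ w (y i - y j)) ∂μ =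
      ∫ w, ∑ i ∈ I, ∑ j ∈ I, s i * s j * Real.cos (inner ℝ w (y i - y j)) ∂μ := by
    rw [integral_finsetSum _ fun i _ => integrable_finsetSum _ fun j _ => (hci _).const_mul _]
    refine Finset.sum_congr rfl fun i _ => ?_
    rw [integral_finsetSum _ fun j _ => (hci _).const_mul _]
  rw [h4]
  refine integral_nonneg fun w => ?_
  have h5 : ∑ i ∈ I, ∑ j ∈ I, s i * s j * Real.cos (inner ℝ w (y i - y j)) =
      (∑ i ∈ I, s i * Real.cos (inner ℝ w (y i))) ^ 2 +
      (∑ i ∈ I, s i * Real.sin (inner ℝ w (y i))) ^ 2 := by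
    rw [sq, sq, Finset.sum_mul_sum, Finset.sum_mul_sum, ← Finset.sum_add_distrib]
    refine Finset.sum_congr rfl fun i _ => ?_
    rw [← Finset.sum_add_distrib]
    refine Finset.sum_congr rfl fun j _ => ?_
    rw [inner_sub_right, Real.cos_sub]
    ring
  simp only [h5]
  positivity

/-- The heat kernel of the plane. -/
noncomputable def heat (t : ℝ) (x : Plane) : ℝ :=
  1 / (4 * Real.pi * t) * Real.exp (-(‖x‖ ^ 2 / (4 * t)))

theorem heat_nonneg {t : ℝ} (ht : 0 < t) (x : Plane) : 0 ≤ heat t x := by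
  unfold heat; positivity

theorem heat_neg (t : ℝ) (x : Plane) : heat t (-x) = heat t x := by
  simp [heat]

theorem heat_sub_comm (t : ℝ) (x y : Plane) : heat t (x - y) = heat t (y - x) := by
  rw [← heat_neg, neg_sub]

/-- The bound is uniform in `t`. It makes the slices integrable down to scale `0` at distinct
points, so the flow can start there without a cutoff. -/
theorem heat_le {t : ℝ} (ht : 0 < t) {x : Plane} (hx : x ≠ 0) :
    heat t x ≤ 1 / (Real.pi * ‖x‖ ^ 2) := by
  have hx' : 0 < ‖x‖ := norm_pos_iff.2 hx
  have hy : 0 < ‖x‖ ^ 2 / (4 * t) := by positivity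
  have h1 : Real.exp (-(‖x‖ ^ 2 / (4 * t))) ≤ (‖x‖ ^ 2 / (4 * t))⁻¹ := by
    rw [Real.exp_neg]
    exact inv_anti₀ hy ((le_add_of_nonneg_right zero_le_one).trans (Real.add_one_le_exp _))
  calc heat t x ≤ 1 / (4 * Real.pi * t) * (‖x‖ ^ 2 / (4 * t))⁻¹ := by
        unfold heat; gcongr
    _ = 1 / (Real.pi * ‖x‖ ^ 2) := by field_simp

theorem measurable_heat : Measurable fun p : ℝ × Plane => heat p.1 p.2 := by
  unfold heat; fun_prop

theorem continuousAt_heat {t : ℝ} (ht : 0 < t) (x : Plane) :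
    ContinuousAt (fun t => heat t x) t := by
  unfold heat
  have : 4 * Real.pi * t ≠ 0 := by positivity
  have : 4 * t ≠ 0 := by positivity
  fun_prop (disch := assumption)

/-- Stability of the heat kernel. -/
theorem neg_le_pairSum_heat {ι : Type*} [LinearOrder ι] {t : ℝ} (ht : 0 < t) (I : Finset ι)
    (s : ι → ℝ) (hs : ∀ i, s i * s i = 1) (x : ι → Plane) :
    -(I.card / 2 * (1 / (4 * Real.pi * t))) ≤
      pairSum (fun i j => s i * s j * heat t (x i - x j)) I := by
  have h1 := sum_mul_exp_neg_norm_sq_nonneg I s fun i => (Real.sqrt (2 * t))⁻¹ • x i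
  have h2 : ∑ i ∈ I, ∑ j ∈ I, s i * s j * heat t (x i - x j) =
      1 / (4 * Real.pi * t) * ∑ i ∈ I, ∑ j ∈ I, s i * s j *
        Real.exp (-(‖(Real.sqrt (2 * t))⁻¹ • x i - (Real.sqrt (2 * t))⁻¹ • x j‖ ^ 2 / 2)) := by
    simp_rw [Finset.mul_sum]
    refine Finset.sum_congr rfl fun i _ => Finset.sum_congr rfl fun j _ => ?_
    rw [← smul_sub, norm_smul, norm_inv, Real.norm_of_nonneg (Real.sqrt_nonneg _), mul_pow, inv_pow,
      Real.sq_sqrt (by positivity), heat]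
    have : ‖x i - x j‖ ^ 2 / (4 * t) = (2 * t)⁻¹ * ‖x i - x j‖ ^ 2 / 2 := by field_simp; ring
    rw [this]
    ring
  have h3 : ∑ i ∈ I, ∑ j ∈ I, s i * s j * heat t (x i - x j) =
      2 * pairSum (fun i j => s i * s j * heat t (x i - x j)) I +
        I.card * (1 / (4 * Real.pi * t)) := by
    -- The nonnegative double sum is twice the sum over pairs plus the self-energies `heat t 0 = 1 /
    -- (4πt)`; the latter are the whole loss in the stability bound.
    have hsplit : ∀ i j : ι, s i * s j * heat t (x i - x j) =
        (if i < j then s i * s j * heat t (x i - x j) else 0) +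
        (if j < i then s j * s i * heat t (x j - x i) else 0) +
        (if i = j then 1 / (4 * Real.pi * t) else 0) := by
      intro i j
      rcases lt_trichotomy i j with h | h | h
      · simp [h, h.ne, h.not_gt]
      · subst h
        rw [if_neg (lt_irrefl i), if_pos rfl, hs, sub_self]
        simp [heat]
      · rw [if_neg h.not_gt, if_pos h, if_neg h.ne', zero_add, add_zero, heat_sub_comm t (x i)]
        ring
    rw [Finset.sum_congr rfl fun i _ => Finset.sum_congr rfl fun j _ => hsplit i j, pairSum_eq,
      two_mul]
    simp_rw [Finset.sum_add_distrib]
    rw [Finset.sum_comm (f := fun i j => if j < i then s j * s i * heat t (x j - x i) else 0)]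
    congr 1
    rw [← nsmul_eq_mul, ← Finset.sum_const]
    refine Finset.sum_congr rfl fun i hi => ?_
    simp [hi]
  have h4 : 0 ≤ 1 / (4 * Real.pi * t) := by positivity
  have h5 := mul_nonneg h4 h1
  rw [← h2, h3] at h5
  linarith

end Gaussian

/-! ### Potentials as superpositions of heat kernels over scales in `(0, 1)`. -/

section Slices

/-- The heat time as a function of the scale parameter `u ∈ (0, 1)`. -/
noncomputable def heatTime (u : ℝ) : ℝ := -Real.log (1 - u)

/-- This replaces the stability constant `1 / τ` by `1 / u`, whose integral between two scales is a
logarithm. -/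
theorem le_heatTime {u : ℝ} (h1 : u < 1) : u ≤ heatTime u := by
  have := Real.log_le_sub_one_of_pos (sub_pos.2 h1)
  unfold heatTime
  linarith

theorem heatTime_pos {u : ℝ} (h0 : 0 < u) (h1 : u < 1) : 0 < heatTime u :=
  h0.trans_le (le_heatTime h1)

theorem measurable_heatTime : Measurable heatTime := by
  unfold heatTime; fun_prop

theorem continuousAt_heatTime {u : ℝ} (h1 : u < 1) : ContinuousAt heatTime u := by
  unfold heatTime
  have : 1 - u ≠ 0 := by linarith
  fun_prop (disch := assumption)

/-- The weights of the scales that occur in potentials with or without cutoff. -/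
structure IsWeight (g : ℝ → ℝ) : Prop where
  continuousOn : ContinuousOn g (Set.Ioo 0 1)
  nonneg : ∀ u ∈ Set.Ioo (0 : ℝ) 1, 0 ≤ g u
  le_one : ∀ u ∈ Set.Ioo (0 : ℝ) 1, g u ≤ 1

/-- The part of the potential at scale `u`. -/
noncomputable def slice (β : ℝ) (g : ℝ → ℝ) (u : ℝ) (x : Plane) : ℝ :=
  β * g u * heat (heatTime u) x

/-- The part of the potential at the scales between `0` and `u`. -/
noncomputable def pot (β : ℝ) (g : ℝ → ℝ) (u : ℝ) (x : Plane) : ℝ :=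
  ∫ s in (0 : ℝ)..u, slice β g s x

variable {β : ℝ} {g : ℝ → ℝ}

theorem slice_sub_comm (u : ℝ) (x y : Plane) : slice β g u (x - y) = slice β g u (y - x) := by
  simp only [slice, heat_sub_comm _ x y]

theorem continuousOn_slice (hg : IsWeight g) (x : Plane) :
    ContinuousOn (fun u => slice β g u x) (Set.Ioo 0 1) := by
  intro u hu
  have h1 : ContinuousAt (fun u => heat (heatTime u) x) u :=
    (continuousAt_heat (heatTime_pos hu.1 hu.2) x).comp (continuousAt_heatTime hu.2)
  exact ((hg.continuousOn u hu).const_mul β).mul h1.continuousWithinAt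

theorem slice_nonneg (hβ : 0 ≤ β) (hg : IsWeight g) {u : ℝ} (hu : u ∈ Set.Ioo (0 : ℝ) 1)
    (x : Plane) : 0 ≤ slice β g u x :=
  mul_nonneg (mul_nonneg hβ (hg.nonneg u hu)) (heat_nonneg (heatTime_pos hu.1 hu.2) x)

theorem slice_le_heat (hβ : 0 ≤ β) (hg : IsWeight g) {u : ℝ} (hu : u ∈ Set.Ioo (0 : ℝ) 1)
    (x : Plane) : slice β g u x ≤ β * heat (heatTime u) x := by
  have h := heat_nonneg (heatTime_pos hu.1 hu.2) x
  exact mul_le_mul_of_nonneg_right (mul_le_of_le_one_right hβ (hg.le_one u hu)) h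

theorem slice_le (hβ : 0 ≤ β) (hg : IsWeight g) {u : ℝ} (hu : u ∈ Set.Ioo (0 : ℝ) 1)
    {x : Plane} (hx : x ≠ 0) : slice β g u x ≤ β * (1 / (Real.pi * ‖x‖ ^ 2)) :=
  (slice_le_heat hβ hg hu x).trans
    (mul_le_mul_of_nonneg_left (heat_le (heatTime_pos hu.1 hu.2) hx) hβ)

theorem intervalIntegrable_slice (hβ : 0 ≤ β) (hg : IsWeight g) {x : Plane} (hx : x ≠ 0) :
    IntervalIntegrable (fun u => slice β g u x) volume 0 1 := by
  rw [intervalIntegrable_iff_integrableOn_Ioo_of_le zero_le_one]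
  refine Integrable.mono' (integrable_const (β * (1 / (Real.pi * ‖x‖ ^ 2))))
    ((continuousOn_slice hg x).aestronglyMeasurable measurableSet_Ioo) ?_
  filter_upwards [ae_restrict_mem measurableSet_Ioo] with u hu
  rw [Real.norm_of_nonneg (slice_nonneg hβ hg hu x)]
  exact slice_le hβ hg hu hx

theorem intervalIntegrable_slice_of_mem (hβ : 0 ≤ β) (hg : IsWeight g) {x : Plane} (hx : x ≠ 0)
    {a b : ℝ} (ha : a ∈ Set.Icc (0 : ℝ) 1) (hb : b ∈ Set.Icc (0 : ℝ) 1) :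
    IntervalIntegrable (fun u => slice β g u x) volume a b := by
  refine (intervalIntegrable_slice hβ hg hx).mono_set ?_
  rw [Set.uIcc_of_le (zero_le_one' ℝ)]
  exact Set.uIcc_subset_Icc ha hb

theorem hasDerivAt_pot (hβ : 0 ≤ β) (hg : IsWeight g) {x : Plane} (hx : x ≠ 0) {u : ℝ}
    (hu : u ∈ Set.Ioo (0 : ℝ) 1) : HasDerivAt (fun u => pot β g u x) (slice β g u x) u :=
  intervalIntegral.integral_hasDerivAt_right
    (intervalIntegrable_slice_of_mem hβ hg hx ⟨le_rfl, zero_le_one⟩ ⟨hu.1.le, hu.2.le⟩)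
    ((continuousOn_slice hg x).stronglyMeasurableAtFilter isOpen_Ioo u hu)
    ((continuousOn_slice hg x).continuousAt (isOpen_Ioo.mem_nhds hu))

theorem continuousOn_pot (hβ : 0 ≤ β) (hg : IsWeight g) {x : Plane} (hx : x ≠ 0) :
    ContinuousOn (fun u => pot β g u x) (Set.Icc 0 1) := by
  have h := (intervalIntegrable_slice hβ hg hx)
  rw [intervalIntegrable_iff_integrableOn_Icc_of_le zero_le_one,
    ← Set.uIcc_of_le (zero_le_one' ℝ)] at h
  have := intervalIntegral.continuousOn_primitive_interval h
  rwa [Set.uIcc_of_le (zero_le_one' ℝ)] at this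

theorem pot_zero (x : Plane) : pot β g 0 x = 0 := by simp [pot]

theorem units_mul_self (s : ℤˣ) : ((s : ℤ) : ℝ) * ((s : ℤ) : ℝ) = 1 := by
  rcases Int.units_eq_one_or s with rfl | rfl <;> simp

theorem abs_units (s : ℤˣ) : |((s : ℤ) : ℝ)| = 1 := by
  rcases Int.units_eq_one_or s with rfl | rfl <;> simp

variable {ι : Type*} [LinearOrder ι]

theorem neg_le_pairSum_slice (hβ : 0 ≤ β) (hg : IsWeight g) {t : ℝ} (ht : t ∈ Set.Ioo (0 : ℝ) 1)
    (I : Finset ι) (σ : ι → ℤˣ) (x : ι → Plane) :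
    -(I.card * (β / (8 * Real.pi)) * t⁻¹) ≤
      pairSum (fun i j => ((σ i : ℤ) : ℝ) * ((σ j : ℤ) : ℝ) * slice β g t (x i - x j)) I := by
  have h1 := neg_le_pairSum_heat (heatTime_pos ht.1 ht.2) I (fun i => ((σ i : ℤ) : ℝ))
    (fun i => units_mul_self (σ i)) x
  have h2 : pairSum (fun i j => ((σ i : ℤ) : ℝ) * ((σ j : ℤ) : ℝ) * slice β g t (x i - x j)) I =
      β * g t * pairSum (fun i j => ((σ i : ℤ) : ℝ) * ((σ j : ℤ) : ℝ) *
        heat (heatTime t) (x i - x j)) I := by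
    rw [pairSum, pairSum, Finset.mul_sum]
    exact Finset.sum_congr rfl fun p _ => by rw [slice]; ring
  have h3 := mul_le_mul_of_nonneg_left h1 (mul_nonneg hβ (hg.nonneg t ht))
  rw [h2]
  refine le_trans ?_ h3
  have ht0 := ht.1
  have hτ := heatTime_pos ht.1 ht.2
  rw [mul_neg, neg_le_neg_iff]
  have h4 : β * g t * (I.card / 2 * (1 / (4 * Real.pi * heatTime t))) =
      I.card * (β / (8 * Real.pi)) * (g t * (heatTime t)⁻¹) := by
    field_simp; ring
  rw [h4]
  refine mul_le_mul_of_nonneg_left ?_ (by positivity)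
  calc g t * (heatTime t)⁻¹ ≤ 1 * t⁻¹ :=
        mul_le_mul (hg.le_one t ht) (inv_anti₀ ht0 (le_heatTime ht.2)) (by positivity) zero_le_one
    _ = t⁻¹ := one_mul _

theorem ne_of_mem_pairs {I : Finset ι} {p : ι × ι} (hp : p ∈ pairs I) : p.1 ≠ p.2 :=
  (mem_pairs.1 hp).2.2.ne

/-- The energy between two scales is bounded below. -/
theorem exp_pairSum_pot_sub_le (hβ : 0 ≤ β) (hg : IsWeight g) {s u : ℝ} (hs : 0 < s)
    (hsu : s < u) (hu : u ≤ 1) (I : Finset ι) (σ : ι → ℤˣ) {x : ι → Plane}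
    (hx : Function.Injective x) :
    Real.exp (pairSum (fun i j => ((σ i : ℤ) : ℝ) * ((σ j : ℤ) : ℝ) * pot β g s (x i - x j)) I -
      pairSum (fun i j => ((σ i : ℤ) : ℝ) * ((σ j : ℤ) : ℝ) * pot β g u (x i - x j)) I) ≤
      (u / s) ^ ((I.card : ℝ) * (β / (8 * Real.pi))) := by
  have hu0 : 0 < u := hs.trans hsu
  have hsm : s ∈ Set.Icc (0 : ℝ) 1 := ⟨hs.le, hsu.le.trans hu⟩
  have hum : u ∈ Set.Icc (0 : ℝ) 1 := ⟨hu0.le, hu⟩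
  have hint : ∀ p ∈ pairs I, IntervalIntegrable (fun t => ((σ p.1 : ℤ) : ℝ) * ((σ p.2 : ℤ) : ℝ) *
      slice β g t (x p.1 - x p.2)) volume s u := fun p hp =>
    (intervalIntegrable_slice_of_mem hβ hg
      (sub_ne_zero.2 (hx.ne (ne_of_mem_pairs hp))) hsm hum).const_mul _
  have h1 : pairSum (fun i j => ((σ i : ℤ) : ℝ) * ((σ j : ℤ) : ℝ) * pot β g u (x i - x j)) I -
      pairSum (fun i j => ((σ i : ℤ) : ℝ) * ((σ j : ℤ) : ℝ) * pot β g s (x i - x j)) I =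
      ∫ t in s..u, pairSum (fun i j => ((σ i : ℤ) : ℝ) * ((σ j : ℤ) : ℝ) *
        slice β g t (x i - x j)) I := by
    simp only [pairSum]
    rw [intervalIntegral.integral_finsetSum hint, ← Finset.sum_sub_distrib]
    refine Finset.sum_congr rfl fun p hp => ?_
    have hne := sub_ne_zero.2 (hx.ne (ne_of_mem_pairs hp))
    have h0m : (0 : ℝ) ∈ Set.Icc (0 : ℝ) 1 := ⟨le_rfl, zero_le_one⟩
    rw [intervalIntegral.integral_const_mul, ← mul_sub, pot, pot,
      intervalIntegral.integral_interval_sub_left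
        (intervalIntegrable_slice_of_mem hβ hg hne h0m hum)
        (intervalIntegrable_slice_of_mem hβ hg hne h0m hsm)]
  have hinv : IntervalIntegrable (fun t : ℝ => t⁻¹) volume s u :=
    intervalIntegral.intervalIntegrable_inv (fun t ht => by
      rw [Set.uIcc_of_le hsu.le] at ht
      exact (hs.trans_le ht.1).ne') continuousOn_id
  -- Stability at each scale, integrated: the energy gained between `s` and `u` is at least `-|I| (β
  -- / 8π) log (u / s)`, which exponentiates to a power of `u / s`.
  have h2 : ∫ t in s..u, -(I.card * (β / (8 * Real.pi)) * t⁻¹) ≤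
      ∫ t in s..u, pairSum (fun i j => ((σ i : ℤ) : ℝ) * ((σ j : ℤ) : ℝ) *
        slice β g t (x i - x j)) I := by
    refine intervalIntegral.integral_mono_on_of_le_Ioo hsu.le (hinv.const_mul _).neg ?_ ?_
    · have h := IntervalIntegrable.sum _ hint
      simpa only [Finset.sum_fn, pairSum] using h
    · intro t ht
      exact neg_le_pairSum_slice hβ hg ⟨hs.trans ht.1, ht.2.trans_le hu⟩ I σ x
  rw [← h1, intervalIntegral.integral_neg, intervalIntegral.integral_const_mul,
    integral_inv_of_pos hs hu0] at h2
  rw [Real.rpow_def_of_pos (by positivity)]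
  exact Real.exp_le_exp.2 (by linarith)

end Slices

/-! ### A pointwise bound on the Ursell functions, uniform in the weights. -/

section Majorant

variable {ι : Type*} [LinearOrder ι]

/-- A bound on the Ursell functions at scale `u` of all potentials whose slices are dominated by
`β` times the heat kernel, from a recursion on the first splitting of the cluster `I`. -/
noncomputable def majorant (β : ℝ) :
    ℕ → Finset ι → ℝ → (ι → Plane) → ENNReal
  | 0, _, _, _ => 1
  | k + 1, I, u, x =>
    if h : 1 < I.card then
      let m := I.min' (Finset.card_pos.1 (zero_lt_one.trans h))
      ∫⁻ s in Set.Ioo 0 u, ENNReal.ofReal ((u / s) ^ ((I.card : ℝ) * (β / (8 * Real.pi)))) *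
        ∑ A ∈ (I.erase m).powerset, ∑ a ∈ insert m A, ∑ b ∈ I.erase m \ A,
          ENNReal.ofReal (β * heat (heatTime s) (x a - x b)) *
            (majorant β k (insert m A) s x * majorant β k (I.erase m \ A) s x)
    else 1

variable {β : ℝ} {g : ℝ → ℝ}

theorem exists_majorant_succ (β : ℝ) (k : ℕ) {I : Finset ι} (h : 1 < I.card) :
    ∃ (m : ι) (K : Finset ι), m ∉ K ∧ I = insert m K ∧ ∀ u x, majorant β (k + 1) I u x =
      ∫⁻ s in Set.Ioo 0 u, ENNReal.ofReal ((u / s) ^ ((I.card : ℝ) * (β / (8 * Real.pi)))) *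
        ∑ A ∈ K.powerset, ∑ a ∈ insert m A, ∑ b ∈ K \ A,
          ENNReal.ofReal (β * heat (heatTime s) (x a - x b)) *
            (majorant β k (insert m A) s x * majorant β k (K \ A) s x) :=
  ⟨I.min' (Finset.card_pos.1 (zero_lt_one.trans h)), I.erase _, Finset.notMem_erase _ I,
    (Finset.insert_erase (Finset.min'_mem I _)).symm, fun u x => by rw [majorant, dif_pos h]⟩

theorem majorant_of_card_le_one (β : ℝ) (k : ℕ) {I : Finset ι} (h : I.card ≤ 1) (u : ℝ)
    (x : ι → Plane) : majorant β k I u x = 1 := by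
  cases k with
  | zero => rfl
  | succ k => rw [majorant, dif_neg h.not_gt]

/-- At distinct points the slices are integrable and all other factors are continuous up to scale
`0`; this is what the fundamental theorem of calculus needs. -/
theorem intervalIntegrable_flow (hβ : 0 ≤ β) (hg : IsWeight g) (σ : ι → ℤˣ) {x : ι → Plane}
    (hx : Function.Injective x) {m : ι} {K : Finset ι} (hm : m ∉ K) {u : ℝ}
    (hu : u ∈ Set.Icc (0 : ℝ) 1) :
    IntervalIntegrable (fun s => -(Real.exp (pairSum (fun i j => ((σ i : ℤ) : ℝ) *
        ((σ j : ℤ) : ℝ) * pot β g s (x i - x j)) (insert m K)) *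
      ∑ A ∈ K.powerset, (∑ a ∈ insert m A, ∑ b ∈ K \ A,
          ((σ a : ℤ) : ℝ) * ((σ b : ℤ) : ℝ) * slice β g s (x a - x b)) *
        (connSum (fun i j => Real.exp (-(((σ i : ℤ) : ℝ) * ((σ j : ℤ) : ℝ) *
          pot β g s (x i - x j))) - 1) (insert m A) *
        connSum (fun i j => Real.exp (-(((σ i : ℤ) : ℝ) * ((σ j : ℤ) : ℝ) *
          pot β g s (x i - x j))) - 1) (K \ A)))) volume 0 u := by
  have h0m : (0 : ℝ) ∈ Set.Icc (0 : ℝ) 1 := ⟨le_rfl, zero_le_one⟩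
  have hsub : Set.uIcc 0 u ⊆ Set.Icc 0 1 := Set.uIcc_subset_Icc h0m hu
  have hpot : ∀ I : Finset ι, ∀ p ∈ pairs I, ContinuousOn (fun s => ((σ p.1 : ℤ) : ℝ) *
      ((σ p.2 : ℤ) : ℝ) * pot β g s (x p.1 - x p.2)) (Set.uIcc 0 u) := fun I p hp =>
    continuousOn_const.mul ((continuousOn_pot hβ hg
      (sub_ne_zero.2 (hx.ne (ne_of_mem_pairs hp)))).mono hsub)
  refine IntervalIntegrable.neg (IntervalIntegrable.continuousOn_mul ?_
    (continuousOn_finsetSum _ (hpot _)).rexp)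
  have hsum : ∀ A ∈ K.powerset, IntervalIntegrable (fun s => (∑ a ∈ insert m A, ∑ b ∈ K \ A,
          ((σ a : ℤ) : ℝ) * ((σ b : ℤ) : ℝ) * slice β g s (x a - x b)) *
        (connSum (fun i j => Real.exp (-(((σ i : ℤ) : ℝ) * ((σ j : ℤ) : ℝ) *
          pot β g s (x i - x j))) - 1) (insert m A) *
        connSum (fun i j => Real.exp (-(((σ i : ℤ) : ℝ) * ((σ j : ℤ) : ℝ) *
          pot β g s (x i - x j))) - 1) (K \ A))) volume 0 u := by
    intro A hA
    refine IntervalIntegrable.mul_continuousOn ?_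
      ((continuousOn_connSum _ (hpot _)).mul (continuousOn_connSum _ (hpot _)))
    have h1 : ∀ a ∈ insert m A, IntervalIntegrable (fun s => ∑ b ∈ K \ A,
        ((σ a : ℤ) : ℝ) * ((σ b : ℤ) : ℝ) * slice β g s (x a - x b)) volume 0 u := by
      intro a ha
      have h2 : ∀ b ∈ K \ A, IntervalIntegrable (fun s =>
          ((σ a : ℤ) : ℝ) * ((σ b : ℤ) : ℝ) * slice β g s (x a - x b)) volume 0 u := by
        intro b hb
        rw [Finset.mem_sdiff] at hb
        have hab : a ≠ b := by
          rintro rfl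
          rcases Finset.mem_insert.1 ha with rfl | ha
          · exact hm hb.1
          · exact hb.2 ha
        exact (intervalIntegrable_slice_of_mem hβ hg (sub_ne_zero.2 (hx.ne hab)) h0m hu).const_mul _
      simpa only [Finset.sum_fn] using IntervalIntegrable.sum _ h2
    simpa only [Finset.sum_fn] using IntervalIntegrable.sum _ h1
  simpa only [Finset.sum_fn] using IntervalIntegrable.sum _ hsum

/-- The Ursell function at scale `u` as an integral over the scale of the last splitting. -/
theorem connSum_eq_integral (hβ : 0 ≤ β) (hg : IsWeight g) (σ : ι → ℤˣ) {x : ι → Plane}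
    (hx : Function.Injective x) {m : ι} {K : Finset ι} (hm : m ∉ K) (hK : K.Nonempty) {u : ℝ}
    (hu : u ∈ Set.Icc (0 : ℝ) 1) :
    connSum (fun i j => Real.exp (-(((σ i : ℤ) : ℝ) * ((σ j : ℤ) : ℝ) *
          pot β g u (x i - x j))) - 1) (insert m K) =
    Real.exp (-pairSum (fun i j => ((σ i : ℤ) : ℝ) *
        ((σ j : ℤ) : ℝ) * pot β g u (x i - x j)) (insert m K)) *
    ∫ s in (0 : ℝ)..u, -(Real.exp (pairSum (fun i j => ((σ i : ℤ) : ℝ) *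
        ((σ j : ℤ) : ℝ) * pot β g s (x i - x j)) (insert m K)) *
      ∑ A ∈ K.powerset, (∑ a ∈ insert m A, ∑ b ∈ K \ A,
          ((σ a : ℤ) : ℝ) * ((σ b : ℤ) : ℝ) * slice β g s (x a - x b)) *
        (connSum (fun i j => Real.exp (-(((σ i : ℤ) : ℝ) * ((σ j : ℤ) : ℝ) *
          pot β g s (x i - x j))) - 1) (insert m A) *
        connSum (fun i j => Real.exp (-(((σ i : ℤ) : ℝ) * ((σ j : ℤ) : ℝ) *
          pot β g s (x i - x j))) - 1) (K \ A))) := by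
  have hpot : ∀ p ∈ pairs (insert m K), ContinuousOn (fun s => ((σ p.1 : ℤ) : ℝ) *
      ((σ p.2 : ℤ) : ℝ) * pot β g s (x p.1 - x p.2)) (Set.Icc 0 u) := fun p hp =>
    continuousOn_const.mul ((continuousOn_pot hβ hg
      (sub_ne_zero.2 (hx.ne (ne_of_mem_pairs hp)))).mono (Set.Icc_subset_Icc_right hu.2))
  have hcont : ContinuousOn (fun s => Real.exp (pairSum (fun i j => ((σ i : ℤ) : ℝ) *
        ((σ j : ℤ) : ℝ) * pot β g s (x i - x j)) (insert m K)) *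
      connSum (fun i j => Real.exp (-(((σ i : ℤ) : ℝ) * ((σ j : ℤ) : ℝ) *
          pot β g s (x i - x j))) - 1) (insert m K)) (Set.Icc 0 u) :=
    (continuousOn_finsetSum _ hpot).rexp.mul (continuousOn_connSum _ hpot)
  have hderiv : ∀ s ∈ Set.Ioo (0 : ℝ) u, _ := fun s hs =>
    hasDerivAt_exp_mul_connSum (u := s)
      (V := fun s i j => ((σ i : ℤ) : ℝ) * ((σ j : ℤ) : ℝ) * pot β g s (x i - x j))
      (w := fun i j => ((σ i : ℤ) : ℝ) * ((σ j : ℤ) : ℝ) * slice β g s (x i - x j))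
      (fun i j => by rw [slice_sub_comm s (x i)]; ring) hm
      (fun p hp => (hasDerivAt_pot hβ hg (sub_ne_zero.2 (hx.ne (ne_of_mem_pairs hp)))
        ⟨hs.1, hs.2.trans_le hu.2⟩).const_mul _)
  rw [intervalIntegral.integral_eq_sub_of_hasDerivAt_of_le hu.1 hcont hderiv
    (intervalIntegrable_flow hβ hg σ hx hm hu)]
  -- The initial condition: without interaction the Ursell function of two or more particles
  -- vanishes.
  have hzero : connSum (fun i j => Real.exp (-(((σ i : ℤ) : ℝ) * ((σ j : ℤ) : ℝ) *
          pot β g 0 (x i - x j))) - 1) (insert m K) = 0 := by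
    have : (fun i j => Real.exp (-(((σ i : ℤ) : ℝ) * ((σ j : ℤ) : ℝ) *
          pot β g 0 (x i - x j))) - 1) = (0 : ι → ι → ℝ) := by
      ext i j
      simp [pot_zero]
    rw [this]
    refine connSum_zero ?_
    rw [Finset.card_insert_of_notMem hm]
    have := hK.card_pos
    omega
  rw [hzero, mul_zero, sub_zero, ← mul_assoc, ← Real.exp_add, neg_add_cancel, Real.exp_zero,
    one_mul]

/-- Take norms in `connSum_eq_integral`. The two exponentials combine to the energy between the
scales `s` and `u`, which stability bounds; the charges have modulus one and the weights are at most
one. The fuel `k` suffices because both parts of a splitting are smaller than `I`. -/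
theorem enorm_connSum_le (hβ : 0 ≤ β) (hg : IsWeight g) (σ : ι → ℤˣ) {x : ι → Plane}
    (hx : Function.Injective x) (k : ℕ) {I : Finset ι} (hI : I.Nonempty) (hk : I.card ≤ k + 1)
    {u : ℝ} (hu : u ∈ Set.Ioc (0 : ℝ) 1) :
    ‖connSum (fun i j => Real.exp (-(((σ i : ℤ) : ℝ) * ((σ j : ℤ) : ℝ) *
          pot β g u (x i - x j))) - 1) I‖ₑ ≤ majorant β k I u x := by
  induction k generalizing I u with
  | zero =>
    obtain ⟨i, rfl⟩ := Finset.card_eq_one.1 (le_antisymm hk hI.card_pos)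
    simp [connSum_singleton, majorant]
  | succ k ih =>
    by_cases h : 1 < I.card
    · obtain ⟨m, K, hmK, hIK, hmaj⟩ := exists_majorant_succ β k h
      rw [hmaj]
      have hcard : K.card + 1 = I.card := by rw [hIK, Finset.card_insert_of_notMem hmK]
      have hK : K.Nonempty := Finset.card_pos.1 (by omega)
      subst hIK
      rw [connSum_eq_integral hβ hg σ hx hmK hK ⟨hu.1.le, hu.2⟩, enorm_mul,
        intervalIntegral.integral_of_le hu.1.le]
      refine (mul_le_mul_right (enorm_integral_le_lintegral_enorm _) _).trans ?_
      rw [← lintegral_const_mul' _ _ enorm_ne_top, ← restrict_Ioo_eq_restrict_Ioc]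
      refine setLIntegral_mono' measurableSet_Ioo fun s hs => ?_
      rw [enorm_neg, enorm_mul, ← mul_assoc, ← enorm_mul, ← Real.exp_add]
      have hs1 : s ∈ Set.Ioo (0 : ℝ) 1 := ⟨hs.1, hs.2.trans_le hu.2⟩
      refine mul_le_mul' ?_ ?_
      · rw [Real.enorm_eq_ofReal (Real.exp_nonneg _), neg_add_eq_sub]
        exact ENNReal.ofReal_le_ofReal
          (exp_pairSum_pot_sub_le hβ hg hs.1 hs.2 hu.2 _ σ hx)
      · refine (enorm_sum_le _ _).trans (Finset.sum_le_sum fun A hA => ?_)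
        have hAK := Finset.mem_powerset.1 hA
        -- The term with an empty second cluster is not a splitting; it is zero on both sides since
        -- the sum over `b` is empty.
        rcases (K \ A).eq_empty_or_nonempty with hB | hB
        · simp [hB]
        rw [enorm_mul, enorm_mul]
        have hcB := hB.card_pos
        have hcA : (insert m A).card = A.card + 1 :=
          Finset.card_insert_of_notMem fun h => hmK (hAK h)
        have hcAB : (K \ A).card + A.card = K.card := Finset.card_sdiff_add_card_eq_card hAK
        have hA1 := ih (I := insert m A) (Finset.insert_nonempty _ _) (by omega)
          (u := s) ⟨hs1.1, hs1.2.le⟩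
        have hB1 := ih (I := K \ A) hB (by omega) (u := s) ⟨hs1.1, hs1.2.le⟩
        refine (mul_le_mul' ((enorm_sum_le _ _).trans (Finset.sum_le_sum fun a _ =>
          (enorm_sum_le _ _).trans (Finset.sum_le_sum (g := fun b =>
            ENNReal.ofReal (β * heat (heatTime s) (x a - x b))) fun b _ => ?_)))
          (mul_le_mul' hA1 hB1)).trans_eq ?_
        · rw [← ofReal_norm, norm_mul, norm_mul, Real.norm_eq_abs, Real.norm_eq_abs, abs_units,
            abs_units, one_mul, one_mul, Real.norm_of_nonneg (slice_nonneg hβ hg hs1 _)]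
          exact ENNReal.ofReal_le_ofReal (slice_le_heat hβ hg hs1 _)
        · simp only [Finset.sum_mul]
    · obtain ⟨i, rfl⟩ := Finset.card_eq_one.1 (le_antisymm (not_lt.1 h) hI.card_pos)
      simp [connSum_singleton, majorant_of_card_le_one]

end Majorant

/-! ### Abel's binomial theorem and the tree numbers `n^(n-2)`. -/

section Abel

/-- Differentiation in `y` leads to the sum of one degree less at `y + 1`, the step of the induction
in `abel_sum`. -/
theorem hasDerivAt_abel_sum (N : ℕ) (y : ℝ) :
    HasDerivAt (fun y : ℝ => ∑ j ∈ Finset.range (N + 2), ((N + 2).choose (j + 1) : ℝ) *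
      ((j : ℝ) + 1) ^ j * (y + ((N + 1 : ℕ) - j)) ^ (N + 1 - j))
    ((N + 2) * ∑ j ∈ Finset.range (N + 1), ((N + 1).choose (j + 1) : ℝ) *
      ((j : ℝ) + 1) ^ j * ((y + 1) + ((N : ℕ) - j)) ^ (N - j)) y := by
  have h : ∀ j ∈ Finset.range (N + 2), HasDerivAt (fun y : ℝ => ((N + 2).choose (j + 1) : ℝ) *
      ((j : ℝ) + 1) ^ j * (y + ((N + 1 : ℕ) - j)) ^ (N + 1 - j))
      (((N + 2).choose (j + 1) : ℝ) * ((j : ℝ) + 1) ^ j *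
        (((N + 1 - j : ℕ) : ℝ) * (y + ((N + 1 : ℕ) - j)) ^ (N + 1 - j - 1) * 1)) y := fun j _ =>
    (((hasDerivAt_id y).add_const _).pow _).const_mul _
  refine (HasDerivAt.fun_sum h).congr_deriv ?_
  rw [Finset.sum_range_succ, Nat.sub_self, Nat.cast_zero]
  simp only [zero_mul, mul_zero, add_zero, mul_one]
  rw [Finset.mul_sum]
  refine Finset.sum_congr rfl fun j hj => ?_
  have hj' : j ≤ N := Nat.lt_succ_iff.1 (Finset.mem_range.1 hj)
  have h1 : ((N + 2).choose (j + 1) : ℝ) * ((N + 1 - j : ℕ) : ℝ) =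
      (N + 2) * ((N + 1).choose (j + 1) : ℝ) := by
    have := Nat.choose_mul_succ_eq (N + 1) (j + 1)
    have h2 : N + 1 + 1 - (j + 1) = N + 1 - j := by omega
    rw [h2] at this
    have h3 : (((N + 1).choose (j + 1) * (N + 1 + 1) : ℕ) : ℝ) =
      (((N + 1 + 1).choose (j + 1) * (N + 1 - j) : ℕ) : ℝ) := by rw [this]
    push_cast at h3 ⊢
    rw [← h3]; ring
  have h4 : N + 1 - j - 1 = N - j := by omega
  have h5 : y + (((N + 1 : ℕ) : ℝ) - j) = (y + 1) + ((N : ℝ) - j) := by push_cast; ring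
  rw [h4, h5]
  linear_combination ((j : ℝ) + 1) ^ j * ((y + 1) + ((N : ℝ) - j)) ^ (N - j) * h1

/-- At `y = -(N + 2)` the two powers merge into a multiple of `(j + 1)^(N + 1)`, and the sum is the
difference of order `N + 2` of a monomial of degree `N + 1`. It fixes the constant of integration in
`abel_sum`. -/
theorem abel_sum_eq_zero (N : ℕ) :
    ∑ j ∈ Finset.range (N + 2), ((N + 2).choose (j + 1) : ℝ) *
      ((j : ℝ) + 1) ^ j * (-((N : ℝ) + 2) + ((N + 1 : ℕ) - j)) ^ (N + 1 - j) = 0 := by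
  have h1 : (fwdDiff (1 : ℝ))^[N + 2] (fun x : ℝ => x ^ (N + 1)) 0 = 0 := by
    rw [fwdDiff_iter_pow_eq_zero_of_lt (by omega)]
    rfl
  rw [fwdDiff_iter_eq_sum_shift, Finset.sum_range_succ'] at h1
  simp only [zero_smul, add_zero, ne_eq, Nat.add_eq_zero_iff, one_ne_zero, and_false,
    not_false_eq_true, zero_pow, smul_zero] at h1
  rw [← h1]
  refine Finset.sum_congr rfl fun j hj => ?_
  have hj' : j ≤ N + 1 := Nat.lt_succ_iff.1 (Finset.mem_range.1 hj)
  obtain ⟨d, hd⟩ := Nat.exists_eq_add_of_le hj'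
  have h2 : N + 1 - j = d := by omega
  have h3 : N + 2 - (j + 1) = d := by omega
  have h4 : (-((N : ℝ) + 2) + (((N + 1 : ℕ) : ℝ) - j)) = (-1) * ((j : ℝ) + 1) := by
    push_cast; ring
  rw [h2, h3, h4, mul_pow, hd]
  simp only [nsmul_eq_mul, zero_add, zsmul_eq_mul]
  push_cast
  rw [mul_one, pow_add]
  ring

/-- A form of Abel's binomial theorem. -/
theorem abel_sum (N : ℕ) (y : ℝ) :
    ∑ j ∈ Finset.range (N + 1), ((N + 1).choose (j + 1) : ℝ) *
      ((j : ℝ) + 1) ^ j * (y + ((N : ℕ) - j)) ^ (N - j) = (N + 1) * (y + N + 1) ^ N := by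
  induction N generalizing y with
  | zero => simp
  | succ N ih =>
    have hd : ∀ y : ℝ, HasDerivAt (fun y : ℝ => (∑ j ∈ Finset.range (N + 2),
        ((N + 2).choose (j + 1) : ℝ) *
        ((j : ℝ) + 1) ^ j * (y + ((N + 1 : ℕ) - j)) ^ (N + 1 - j)) -
        (N + 2) * (y + N + 2) ^ (N + 1)) 0 y := by
      intro y
      have h1 : HasDerivAt (fun y : ℝ => ((N : ℝ) + 2) * (y + N + 2) ^ (N + 1))
          (((N : ℝ) + 2) * (((N + 1 : ℕ) : ℝ) * (y + N + 2) ^ N * 1)) y :=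
        ((((hasDerivAt_id y).add_const _).add_const _).pow _).const_mul _
      refine ((hasDerivAt_abel_sum N y).sub h1).congr_deriv ?_
      rw [ih]
      push_cast
      ring
    have hconst := is_const_of_deriv_eq_zero (fun y => (hd y).differentiableAt)
      (fun y => (hd y).deriv) y (-((N : ℝ) + 2))
    simp only [abel_sum_eq_zero] at hconst
    have h0 : (-((N : ℝ) + 2) + N + 2) ^ (N + 1) = 0 := by
      rw [show -((N : ℝ) + 2) + N + 2 = 0 by ring]
      simp
    rw [h0, mul_zero, sub_zero, sub_eq_zero] at hconst
    push_cast at hconst ⊢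
    rw [show (N : ℝ) + 1 + 1 = N + 2 by ring, show y + ((N : ℝ) + 1) + 1 = y + N + 2 by ring]
    exact hconst

/-- The bound `θ ^ (n - 1) n ^ (n - 2)` on the integrals of the Ursell functions. -/
noncomputable def treeBound (θ : ℝ) (n : ℕ) : ℝ := θ ^ (n - 1) * (n : ℝ) ^ (n - 2)

theorem treeBound_nonneg {θ : ℝ} (hθ : 0 ≤ θ) (n : ℕ) : 0 ≤ treeBound θ n := by
  unfold treeBound; positivity

theorem treeBound_one (θ : ℝ) : treeBound θ 1 = 1 := by simp [treeBound]

theorem succ_mul_treeBound (θ : ℝ) (m : ℕ) :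
    ((m : ℝ) + 1) * treeBound θ (m + 1) = θ ^ m * ((m : ℝ) + 1) ^ m := by
  cases m with
  | zero => simp [treeBound]
  | succ m =>
    simp only [treeBound, Nat.add_sub_cancel, show m + 1 + 1 - 2 = m by omega]
    push_cast
    ring

/-- This is the sum over the splittings of `N + 2` particles, with the choice of the endpoint of the
joining edge in each part. By `succ_mul_treeBound` each part contributes a rooted tree number, and
Abel's identity at `y = 1` applies. The term `m = N + 1`, an empty second part, has the factor zero.
-/
theorem sum_treeBound (θ : ℝ) (N : ℕ) :
    ∑ m ∈ Finset.range (N + 2), ((N + 1).choose m : ℝ) * (((m : ℝ) + 1) * treeBound θ (m + 1)) *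
      (((N + 1 - m : ℕ) : ℝ) * treeBound θ (N + 1 - m)) = θ ^ N * ((N + 1) * ((N : ℝ) + 2) ^ N) := by
  have h := abel_sum N 1
  rw [← Finset.sum_range_reflect] at h
  rw [Finset.sum_range_succ, Nat.sub_self]
  simp only [Nat.cast_zero, zero_mul, mul_zero, add_zero]
  rw [show (1 : ℝ) + N + 1 = N + 2 by ring] at h
  rw [← h, Finset.mul_sum]
  refine Finset.sum_congr rfl fun m hm => ?_
  have hm' : m ≤ N := Nat.lt_succ_iff.1 (Finset.mem_range.1 hm)
  obtain ⟨d, rfl⟩ := Nat.exists_eq_add_of_le hm'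
  have e1 : m + d + 1 - m = d + 1 := by omega
  have e2 : m + d + 1 - 1 - m = d := by omega
  have e3 : m + d - d = m := by omega
  have e4 : (m + d + 1).choose (d + 1) = (m + d + 1).choose m := by
    rw [← Nat.choose_symm_of_eq_add (by omega : m + d + 1 = m + (d + 1))]
  rw [e1, e2, e3, e4, succ_mul_treeBound]
  push_cast
  rw [succ_mul_treeBound]
  ring

end Abel

/-! ### The integrals over one position and over one scale. -/

section Integrals

theorem lintegral_heat {t : ℝ} (ht : 0 < t) : ∫⁻ x, ENNReal.ofReal (heat t x) = 1 := by
  have hb : 0 < 1 / (4 * t) := by positivity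
  have h1 := GaussianFourier.integral_rexp_neg_mul_sq_norm (V := Plane) hb
  have h2 : ∫ x, heat t x = 1 := by
    have : ∀ x, heat t x = 1 / (4 * Real.pi * t) * Real.exp (-(1 / (4 * t)) * ‖x‖ ^ 2) := by
      intro x
      rw [heat]
      congr 2
      ring
    simp_rw [this]
    rw [integral_const_mul, h1]
    simp only [finrank_euclideanSpace, Fintype.card_fin]
    norm_num
    field_simp
  -- The integral of a function that is not integrable is `0` by convention, so the value `1` forces
  -- integrability.
  have hint : Integrable (heat t) := by
    by_contra h
    rw [integral_undef h] at h2
    exact zero_ne_one h2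
  rw [← ofReal_integral_eq_lintegral_ofReal hint (Eventually.of_forall fun x => heat_nonneg ht x),
    h2, ENNReal.ofReal_one]

theorem lintegral_mul_heat_sub {β : ℝ} (hβ : 0 ≤ β) {t : ℝ} (ht : 0 < t) (y : Plane) :
    ∫⁻ x, ENNReal.ofReal (β * heat t (y - x)) = ENNReal.ofReal β := by
  have hm : Measurable fun x => ENNReal.ofReal (heat t x) :=
    (measurable_heat.comp (measurable_const.prodMk measurable_id)).ennreal_ofReal
  simp_rw [ENNReal.ofReal_mul hβ]
  rw [lintegral_const_mul' _ _ ENNReal.ofReal_ne_top,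
    lintegral_sub_left_eq_self (fun x => ENNReal.ofReal (heat t x)) y, lintegral_heat ht, mul_one]

/-- The hypothesis `p < n + 1` is integrability at `s = 0`; with `p = (n + 2) β / 8π` for a cluster
of `n + 2` particles it becomes the threshold `β < 4π`. -/
theorem lintegral_scale {p u : ℝ} {n : ℕ} (hu : 0 < u) (hp : p < n + 1) :
    ∫⁻ s in Set.Ioo 0 u, ENNReal.ofReal ((u / s) ^ p * s ^ n) =
      ENNReal.ofReal (u ^ (n + 1) / (n + 1 - p)) := by
  have hr : -1 < (n : ℝ) - p := by linarith
  have h1 : ∀ s ∈ Set.Ioo 0 u, (u / s) ^ p * s ^ n = u ^ p * s ^ ((n : ℝ) - p) := by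
    intro s hs
    rw [Real.div_rpow hu.le hs.1.le, Real.rpow_sub hs.1, Real.rpow_natCast]
    ring
  have hint : IntegrableOn (fun s : ℝ => u ^ p * s ^ ((n : ℝ) - p)) (Set.Ioo 0 u) := by
    rw [← intervalIntegrable_iff_integrableOn_Ioo_of_le hu.le]
    exact (intervalIntegral.intervalIntegrable_rpow' hr).const_mul _
  rw [setLIntegral_congr_fun measurableSet_Ioo fun s hs => by rw [h1 s hs],
    ← ofReal_integral_eq_lintegral_ofReal hint]
  · rw [← integral_Ioc_eq_integral_Ioo, ← intervalIntegral.integral_of_le hu.le,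
      intervalIntegral.integral_const_mul, integral_rpow (Or.inl hr), Real.zero_rpow (by linarith),
      sub_zero, mul_div_assoc', ← Real.rpow_add hu, ← Real.rpow_natCast]
    congr 2
    · congr 1; push_cast; ring
    · ring
  · filter_upwards [ae_restrict_mem measurableSet_Ioo] with s hs
    have := hs.1
    simp only [Pi.zero_apply]
    positivity

end Integrals

/-! ### The integral of the majorant over all positions but one. -/

section Marginals

variable {ι : Type*} [LinearOrder ι]

/-- That the majorant only sees the positions in its cluster lets the integrals over two disjoint
clusters separate. -/
theorem majorant_congr (β : ℝ) (k : ℕ) {I : Finset ι} {x y : ι → Plane}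
    (h : ∀ i ∈ I, x i = y i) (u : ℝ) : majorant β k I u x = majorant β k I u y := by
  induction k generalizing I u with
  | zero => rfl
  | succ k ih =>
    by_cases hI : 1 < I.card
    · obtain ⟨m, K, hmK, rfl, hmaj⟩ := exists_majorant_succ β k hI
      rw [hmaj, hmaj]
      refine lintegral_congr fun s => ?_
      congr 1
      refine Finset.sum_congr rfl fun A hA => Finset.sum_congr rfl fun a ha =>
        Finset.sum_congr rfl fun b hb => ?_
      have hA1 : insert m A ⊆ insert m K := Finset.insert_subset_insert m (Finset.mem_powerset.1 hA)
      have hB1 : K \ A ⊆ insert m K := Finset.sdiff_subset.trans (Finset.subset_insert m K)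
      rw [ih fun i hi => h i (hA1 hi), ih fun i hi => h i (hB1 hi), h a (hA1 ha), h b (hB1 hb)]
    · rw [majorant_of_card_le_one _ _ (not_lt.1 hI), majorant_of_card_le_one _ _ (not_lt.1 hI)]

theorem measurable_majorant (β : ℝ) (k : ℕ) (I : Finset ι) :
    Measurable fun q : ℝ × (ι → Plane) => majorant β k I q.1 q.2 := by
  induction k generalizing I with
  | zero => exact measurable_const
  | succ k ih =>
    by_cases hI : 1 < I.card
    · obtain ⟨m, K, hmK, hIK, hmaj⟩ := exists_majorant_succ β k hI
      simp_rw [hmaj, ← lintegral_indicator measurableSet_Ioo]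
      refine Measurable.lintegral_prod_right' (f := fun q : (ℝ × (ι → Plane)) × ℝ =>
        (Set.Ioo 0 q.1.1).indicator (fun s =>
          ENNReal.ofReal ((q.1.1 / s) ^ ((I.card : ℝ) * (β / (8 * Real.pi)))) *
        ∑ A ∈ K.powerset, ∑ a ∈ insert m A, ∑ b ∈ K \ A,
          ENNReal.ofReal (β * heat (heatTime s) (q.1.2 a - q.1.2 b)) *
            (majorant β k (insert m A) s q.1.2 * majorant β k (K \ A) s q.1.2)) q.2) ?_
      have hset : MeasurableSet {q : (ℝ × (ι → Plane)) × ℝ | q.2 ∈ Set.Ioo 0 q.1.1} :=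
        (measurableSet_lt measurable_const measurable_snd).inter
          (measurableSet_lt measurable_snd measurable_fst.fst)
      refine Measurable.ite hset ?_ measurable_const
      refine Measurable.mul (by fun_prop) ?_
      refine Finset.measurable_fun_sum _ fun A _ => Finset.measurable_fun_sum _ fun a _ =>
        Finset.measurable_fun_sum _ fun b _ => ?_
      have hsx : Measurable fun q : (ℝ × (ι → Plane)) × ℝ => (q.2, q.1.2) := by fun_prop
      refine Measurable.mul ?_ (((ih _).comp hsx).mul ((ih _).comp hsx))
      refine (Measurable.const_mul (measurable_heat.comp (Measurable.prodMk
        (measurable_heatTime.comp measurable_snd) ?_)) β).ennreal_ofReal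
      exact ((measurable_pi_apply a).comp measurable_fst.snd).sub
        ((measurable_pi_apply b).comp measurable_fst.snd)
    · simp_rw [majorant_of_card_le_one _ _ (not_lt.1 hI)]
      exact measurable_const

theorem measurable_majorant_right (β : ℝ) (k : ℕ) (I : Finset ι) (u : ℝ) :
    Measurable fun x : ι → Plane => majorant β k I u x :=
  (measurable_majorant β k I).comp (measurable_const.prodMk measurable_id)

/-- Integration over two clusters joined by an edge. -/
theorem lmarginal_edge_le {E : Type*} [MeasureSpace E] [SigmaFinite (volume : Measure E)]
    {A B : Finset ι} (hAB : Disjoint A B) {r a b : ι} (hr : r ∈ A) (ha : a ∈ A) (hb : b ∈ B)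
    {F H : (ι → E) → ENNReal} {W : E → E → ENNReal} (hF : Measurable F) (hH : Measurable H)
    (hW : Measurable (Function.uncurry W)) (hFA : ∀ x y, (∀ i ∈ A, x i = y i) → F x = F y)
    {cF cH cW : ENNReal}
    (hcF : ∀ x, lmarginal (fun _ => volume) (A.erase r) F x ≤ cF)
    (hcH : ∀ x, lmarginal (fun _ => volume) (B.erase b) H x ≤ cH)
    (hcW : ∀ y, ∫⁻ z, W y z ≤ cW) (x : ι → E) :
    lmarginal (fun _ => volume) ((A ∪ B).erase r) (fun x => W (x a) (x b) * (F x * H x)) x ≤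
      cW * (cF * cH) := by
  have hrB : r ∉ B := Finset.disjoint_left.1 hAB hr
  have hset : (A ∪ B).erase r = A.erase r ∪ B := by
    rw [Finset.erase_union_distrib, Finset.erase_eq_of_notMem hrB]
  have hWm : Measurable fun x : ι → E => W (x a) (x b) :=
    hW.comp (f := fun x : ι → E => (x a, x b)) (by fun_prop)
  have hm : Measurable fun x : ι → E => W (x a) (x b) * (F x * H x) := hWm.mul (hF.mul hH)
  have hdisj : Disjoint (A.erase r) B := Finset.disjoint_of_subset_left (Finset.erase_subset r A) hAB
  rw [hset, lmarginal_union _ _ hm hdisj]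
  -- The positions in `B` other than `b` occur in `H` alone. They are integrated first, with `b` as
  -- the root of `B`.
  have hinner : ∀ z : ι → E, lmarginal (fun _ => volume) (B.erase b)
      (fun x => W (x a) (x b) * (F x * H x)) z ≤ W (z a) (z b) * (F z * cH) := by
    intro z
    have h1 : ∀ w : (i : B.erase b) → E, W (Function.updateFinset z (B.erase b) w a)
        (Function.updateFinset z (B.erase b) w b) * (F (Function.updateFinset z (B.erase b) w) *
          H (Function.updateFinset z (B.erase b) w)) =
        W (z a) (z b) * F z * H (Function.updateFinset z (B.erase b) w) := by
      intro w
      have hnot : ∀ i ∈ A, i ∉ B.erase b := fun i hi h =>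
        Finset.disjoint_left.1 hAB hi (Finset.mem_of_mem_erase h)
      have h2 : ∀ i ∉ B.erase b, Function.updateFinset z (B.erase b) w i = z i := by
        intro i hi
        simp only [Function.updateFinset, dif_neg hi]
      rw [h2 a (hnot a ha), h2 b (Finset.notMem_erase b B),
        hFA _ z fun i hi => h2 i (hnot i hi), mul_assoc]
    rw [lmarginal, lintegral_congr h1, lintegral_const_mul
      (f := fun w => H (Function.updateFinset z (B.erase b) w)) _ (hH.comp measurable_updateFinset),
      mul_assoc]
    exact mul_le_mul' le_rfl (mul_le_mul' le_rfl (hcH z))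
  -- Now `x b` occurs in the edge factor alone and contributes `cW`; what is left is the integral of
  -- `F` over `A` without its root.
  have houter : lmarginal (fun _ => volume) B (fun x => W (x a) (x b) * (F x * H x)) ≤
      fun z => F z * (cW * cH) := by
    intro z
    rw [lmarginal_erase _ hm hb]
    calc ∫⁻ y, lmarginal (fun _ => volume) (B.erase b) (fun x => W (x a) (x b) * (F x * H x))
          (Function.update z b y)
        ≤ ∫⁻ y, W (z a) y * (F z * cH) := by
          refine lintegral_mono fun y => (hinner _).trans_eq ?_
          have hab : a ≠ b := fun h => Finset.disjoint_left.1 hAB ha (h ▸ hb)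
          rw [Function.update_of_ne hab, Function.update_self, hFA (Function.update z b y) z]
          intro i hi
          have hib : i ≠ b := fun h => Finset.disjoint_left.1 hAB hi (h ▸ hb)
          exact Function.update_of_ne hib _ _
      _ = (∫⁻ y, W (z a) y) * (F z * cH) :=
          lintegral_mul_const _ (hW.comp (measurable_const.prodMk measurable_id))
      _ ≤ cW * (F z * cH) := mul_le_mul' (hcW _) le_rfl
      _ = F z * (cW * cH) := by ring
  refine (lmarginal_mono houter x).trans ?_
  rw [lmarginal, lintegral_mul_const (f := fun w => F (Function.updateFinset x (A.erase r) w)) _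
    (hF.comp measurable_updateFinset)]
  refine (mul_le_mul' (hcF x) le_rfl).trans_eq (by ring)

theorem lmarginal_finsetSum {E κ : Type*} [MeasureSpace E] (S : Finset ι) (T : Finset κ)
    {f : κ → (ι → E) → ENNReal} (hf : ∀ c ∈ T, Measurable (f c)) (x : ι → E) :
    lmarginal (fun _ => volume) S (fun x => ∑ c ∈ T, f c x) x =
      ∑ c ∈ T, lmarginal (fun _ => volume) S (f c) x :=
  lintegral_finsetSum _ fun c hc => (hf c hc).comp measurable_updateFinset

/-- The fixed position `r` may lie in either part. The part that contains it keeps `r` as its root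
and the other part is rooted at its end of the joining edge, which is why the induction hypothesis
is needed for every root. -/
theorem lmarginal_majorant_step_le {β : ℝ} (hβ : 0 ≤ β) {θ : ℝ} (hθ : 0 ≤ θ) {k : ℕ}
    (ih : ∀ I : Finset ι, I.card ≤ k + 1 → ∀ r ∈ I, ∀ u ∈ Set.Ioc (0 : ℝ) 1, ∀ x : ι → Plane,
      lmarginal (fun _ => volume) (I.erase r) (majorant β k I u) x ≤
        ENNReal.ofReal (treeBound θ I.card * u ^ (I.card - 1)))
    {A B : Finset ι} (hAB : Disjoint A B) (hA : A.card ≤ k + 1) (hB : B.card ≤ k + 1)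
    {r a b : ι} (hr : r ∈ A ∪ B) (ha : a ∈ A) (hb : b ∈ B) {s : ℝ} (hs : s ∈ Set.Ioo (0 : ℝ) 1)
    (x : ι → Plane) :
    lmarginal (fun _ => volume) ((A ∪ B).erase r) (fun x =>
      ENNReal.ofReal (β * heat (heatTime s) (x a - x b)) *
        (majorant β k A s x * majorant β k B s x)) x ≤
      ENNReal.ofReal (β * (treeBound θ A.card * treeBound θ B.card) *
        s ^ (A.card + B.card - 2)) := by
  have hs' : s ∈ Set.Ioc (0 : ℝ) 1 := ⟨hs.1, hs.2.le⟩
  have hτ := heatTime_pos hs.1 hs.2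
  have hW : Measurable (Function.uncurry fun y z : Plane =>
      ENNReal.ofReal (β * heat (heatTime s) (y - z))) :=
    (Measurable.const_mul (measurable_heat.comp (measurable_const.prodMk
      (measurable_fst.sub measurable_snd))) β).ennreal_ofReal
  have hcA : 1 ≤ A.card := Finset.card_pos.2 ⟨a, ha⟩
  have hcB : 1 ≤ B.card := Finset.card_pos.2 ⟨b, hb⟩
  have hpow : s ^ (A.card + B.card - 2) = s ^ (A.card - 1) * s ^ (B.card - 1) := by
    rw [← pow_add]
    congr 1
    omega
  have hnA : 0 ≤ treeBound θ A.card * s ^ (A.card - 1) :=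
    mul_nonneg (treeBound_nonneg hθ _) (pow_nonneg hs.1.le _)
  have hR : ENNReal.ofReal (β * (treeBound θ A.card * treeBound θ B.card) *
        s ^ (A.card + B.card - 2)) = ENNReal.ofReal β *
      (ENNReal.ofReal (treeBound θ A.card * s ^ (A.card - 1)) *
        ENNReal.ofReal (treeBound θ B.card * s ^ (B.card - 1))) := by
    rw [← ENNReal.ofReal_mul hnA, ← ENNReal.ofReal_mul hβ, hpow]
    congr 1
    ring
  rw [hR]
  rcases Finset.mem_union.1 hr with hrA | hrB
  · exact lmarginal_edge_le hAB hrA ha hb (measurable_majorant_right β k A s)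
      (measurable_majorant_right β k B s) hW (fun x y h => majorant_congr β k h s)
      (ih A hA r hrA s hs') (ih B hB b hb s hs')
      (fun y => (lintegral_mul_heat_sub hβ hτ y).le) x
  · have h := lmarginal_edge_le hAB.symm hrB hb ha (measurable_majorant_right β k B s)
      (measurable_majorant_right β k A s) hW (fun x y h => majorant_congr β k h s)
      (ih B hB r hrB s hs') (ih A hA a ha s hs')
      (fun y => (lintegral_mul_heat_sub hβ hτ y).le) x
    rw [Finset.union_comm]
    convert h using 2
    · ext z
      rw [heat_sub_comm, mul_comm (majorant β k A s z)]
    · rw [mul_comm]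

/-- The integral of the majorant over all but one position. -/
theorem lmarginal_majorant_le {β : ℝ} (hβ : 0 < β) (hβ' : β < 4 * Real.pi) (k : ℕ)
    (I : Finset ι) (hk : I.card ≤ k + 1) (r : ι) (hr : r ∈ I) (u : ℝ)
    (hu : u ∈ Set.Ioc (0 : ℝ) 1) (x : ι → Plane) :
    lmarginal (fun _ => volume) (I.erase r) (majorant β k I u) x ≤
      ENNReal.ofReal (treeBound (4 * Real.pi * β / (4 * Real.pi - β)) I.card *
        u ^ (I.card - 1)) := by
  set θ := 4 * Real.pi * β / (4 * Real.pi - β) with hθdef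
  have hπ := Real.pi_pos
  have hd : 0 < 4 * Real.pi - β := by linarith
  have hθ : 0 ≤ θ := by positivity
  induction k generalizing I r u x with
  | zero =>
    have h1 : I.card = 1 := le_antisymm hk (Finset.card_pos.2 ⟨r, hr⟩)
    obtain ⟨i, rfl⟩ := Finset.card_eq_one.1 h1
    obtain rfl : r = i := by simpa using hr
    simp [majorant, treeBound_one]
  | succ k ih =>
    by_cases hI : 1 < I.card
    swap
    · have h1 : I.card = 1 := le_antisymm (not_lt.1 hI) (Finset.card_pos.2 ⟨r, hr⟩)
      obtain ⟨i, rfl⟩ := Finset.card_eq_one.1 h1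
      obtain rfl : r = i := by simpa using hr
      simp [majorant_of_card_le_one, treeBound_one]
    obtain ⟨m, K, hmK, hIK, hmaj⟩ := exists_majorant_succ β k hI
    have hcard : I.card = K.card + 1 := by rw [hIK, Finset.card_insert_of_notMem hmK]
    obtain ⟨N, hN⟩ : ∃ N, K.card = N + 1 := ⟨K.card - 1, by omega⟩
    obtain ⟨S, hS⟩ : ∃ S : (ι → Plane) → ℝ → ENNReal, ∀ x s, S x s =
        ENNReal.ofReal ((u / s) ^ ((I.card : ℝ) * (β / (8 * Real.pi)))) *
        ∑ A ∈ K.powerset, ∑ a ∈ insert m A, ∑ b ∈ K \ A,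
          ENNReal.ofReal (β * heat (heatTime s) (x a - x b)) *
            (majorant β k (insert m A) s x * majorant β k (K \ A) s x) := ⟨_, fun _ _ => rfl⟩
    have hmS : Measurable fun q : (ι → Plane) × ℝ => S q.1 q.2 := by
      simp_rw [hS]
      refine Measurable.mul (by fun_prop) ?_
      refine Finset.measurable_fun_sum _ fun A _ => Finset.measurable_fun_sum _ fun a _ =>
        Finset.measurable_fun_sum _ fun b _ => ?_
      refine Measurable.mul ?_ (((measurable_majorant β k _).comp measurable_swap).mul
        ((measurable_majorant β k _).comp measurable_swap))
      exact (Measurable.const_mul (measurable_heat.comp (Measurable.prodMk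
        (measurable_heatTime.comp measurable_snd) (((measurable_pi_apply a).comp measurable_fst).sub
        ((measurable_pi_apply b).comp measurable_fst)))) β).ennreal_ofReal
    rw [lmarginal]
    simp_rw [hmaj, ← hS]
    -- By Tonelli the positions are integrated first, at a fixed scale `s` of the splitting.
    rw [lintegral_lintegral_swap (f := fun y s => S (Function.updateFinset x (I.erase r) y) s)
      (hmS.comp ((measurable_updateFinset.comp measurable_fst).prodMk measurable_snd)).aemeasurable]
    have hbound : ∀ s ∈ Set.Ioo 0 u, lmarginal (fun _ => volume) (I.erase r) (fun x => S x s) x ≤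
        ENNReal.ofReal (β * (θ ^ N * ((N + 1) * ((N : ℝ) + 2) ^ N))) * ENNReal.ofReal
          ((u / s) ^ ((I.card : ℝ) * (β / (8 * Real.pi))) * s ^ N) := by
      intro s hs
      have hs1 : s ∈ Set.Ioo (0 : ℝ) 1 := ⟨hs.1, hs.2.trans_le hu.2⟩
      have hmt : ∀ (A : Finset ι) (a b : ι), Measurable fun x : ι → Plane =>
          ENNReal.ofReal (β * heat (heatTime s) (x a - x b)) *
            (majorant β k (insert m A) s x * majorant β k (K \ A) s x) := fun A a b =>
        ((Measurable.const_mul (measurable_heat.comp (measurable_const.prodMk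
          ((measurable_pi_apply a).sub (measurable_pi_apply b)))) β).ennreal_ofReal).mul
          ((measurable_majorant_right β k _ s).mul (measurable_majorant_right β k _ s))
      simp_rw [hS]
      rw [lmarginal, lintegral_const_mul' _ _ ENNReal.ofReal_ne_top]
      change _ * lmarginal (fun _ => volume) (I.erase r) (fun x =>
        ∑ A ∈ K.powerset, ∑ a ∈ insert m A, ∑ b ∈ K \ A,
          ENNReal.ofReal (β * heat (heatTime s) (x a - x b)) *
            (majorant β k (insert m A) s x * majorant β k (K \ A) s x)) x ≤ _
      rw [lmarginal_finsetSum _ _ fun A _ => Finset.measurable_fun_sum _ fun a _ =>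
        Finset.measurable_fun_sum _ fun b _ => hmt A a b]
      have hA : ∀ A ∈ K.powerset, lmarginal (fun _ => volume) (I.erase r) (fun x =>
          ∑ a ∈ insert m A, ∑ b ∈ K \ A,
          ENNReal.ofReal (β * heat (heatTime s) (x a - x b)) *
            (majorant β k (insert m A) s x * majorant β k (K \ A) s x)) x ≤
          ENNReal.ofReal (β * ((((A.card : ℝ) + 1) * treeBound θ (A.card + 1)) *
            (((N + 1 - A.card : ℕ) : ℝ) * treeBound θ (N + 1 - A.card))) * s ^ N) := by
        intro A hA
        have hAK := Finset.mem_powerset.1 hA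
        have hcA : (insert m A).card = A.card + 1 :=
          Finset.card_insert_of_notMem fun h => hmK (hAK h)
        have hcB : (K \ A).card = N + 1 - A.card := by
          rw [Finset.card_sdiff_of_subset hAK, hN]
        have hAle : A.card ≤ N + 1 := hN ▸ Finset.card_le_card hAK
        have hd : Disjoint (insert m A) (K \ A) := by
          rw [Finset.disjoint_insert_left]
          exact ⟨fun h => hmK (Finset.mem_sdiff.1 h).1, Finset.disjoint_sdiff⟩
        have hun : insert m A ∪ K \ A = I := by
          rw [Finset.insert_union, Finset.union_sdiff_of_subset hAK, hIK]
        rw [lmarginal_finsetSum _ _ fun a _ => Finset.measurable_fun_sum _ fun b _ => hmt A a b]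
        have hterm : ∀ a ∈ insert m A, ∀ b ∈ K \ A, lmarginal (fun _ => volume) (I.erase r)
            (fun x => ENNReal.ofReal (β * heat (heatTime s) (x a - x b)) *
            (majorant β k (insert m A) s x * majorant β k (K \ A) s x)) x ≤
            ENNReal.ofReal (β * (treeBound θ (A.card + 1) * treeBound θ (N + 1 - A.card)) *
              s ^ N) := by
          intro a ha b hb
          have hbc : 1 ≤ (K \ A).card := Finset.card_pos.2 ⟨b, hb⟩
          have h := lmarginal_majorant_step_le hβ.le hθ (r := r)
            (fun I hI r hr u hu x => ih I hI r hr u hu x) hd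
            (by omega) (by omega) (by rw [hun]; exact hr) ha hb hs1 x
          rw [hun, hcA, hcB, show A.card + 1 + (N + 1 - A.card) - 2 = N by omega] at h
          exact h
        calc ∑ a ∈ insert m A, lmarginal (fun _ => volume) (I.erase r) (fun x => ∑ b ∈ K \ A,
              ENNReal.ofReal (β * heat (heatTime s) (x a - x b)) *
              (majorant β k (insert m A) s x * majorant β k (K \ A) s x)) x
            ≤ ∑ a ∈ insert m A, ∑ b ∈ K \ A, ENNReal.ofReal (β * (treeBound θ (A.card + 1) *
                treeBound θ (N + 1 - A.card)) * s ^ N) := by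
              refine Finset.sum_le_sum fun a ha => ?_
              rw [lmarginal_finsetSum _ _ fun b _ => hmt A a b]
              exact Finset.sum_le_sum fun b hb => hterm a ha b hb
          _ = _ := by
              rw [Finset.sum_const, Finset.sum_const, hcA, hcB, ← ENNReal.ofReal_nsmul,
                ← ENNReal.ofReal_nsmul, nsmul_eq_mul, nsmul_eq_mul]
              congr 1
              push_cast
              ring
      have hnn : ∀ j : ℕ, 0 ≤ β * ((((j : ℝ) + 1) * treeBound θ (j + 1)) *
            (((N + 1 - j : ℕ) : ℝ) * treeBound θ (N + 1 - j))) * s ^ N := fun j => by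
        have := treeBound_nonneg hθ (j + 1)
        have := treeBound_nonneg hθ (N + 1 - j)
        have := hs.1
        positivity
      -- The bound depends on `A` only through its size, so the binomial coefficients of
      -- `sum_treeBound` count the subsets.
      have hcomb : ∑ A ∈ K.powerset, β * ((((A.card : ℝ) + 1) * treeBound θ (A.card + 1)) *
            (((N + 1 - A.card : ℕ) : ℝ) * treeBound θ (N + 1 - A.card))) * s ^ N =
          β * (θ ^ N * ((N + 1) * ((N : ℝ) + 2) ^ N)) * s ^ N := by
        rw [Finset.sum_powerset_apply_card (fun j : ℕ =>
          β * ((((j : ℝ) + 1) * treeBound θ (j + 1)) *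
            (((N + 1 - j : ℕ) : ℝ) * treeBound θ (N + 1 - j))) * s ^ N), hN, ← sum_treeBound,
          Finset.mul_sum, Finset.sum_mul]
        refine Finset.sum_congr rfl fun j _ => ?_
        rw [nsmul_eq_mul]
        ring
      refine (mul_le_mul' le_rfl (Finset.sum_le_sum hA)).trans_eq ?_
      rw [← ENNReal.ofReal_sum_of_nonneg fun A _ => hnn A.card, hcomb,
        ENNReal.ofReal_mul (p := β * _) (by positivity),
        ENNReal.ofReal_mul (p := (u / s) ^ _) (Real.rpow_nonneg (div_nonneg hu.1.le hs.1.le) _)]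
      ring
    refine (setLIntegral_mono' measurableSet_Ioo hbound).trans ?_
    -- For `|I| = N + 2` this is `(N + 2) β < 8π (N + 1)`; it is strongest at `N = 0`, where it is
    -- `β < 4π`.
    have hp : (I.card : ℝ) * (β / (8 * Real.pi)) < (N : ℝ) + 1 := by
      rw [hcard, hN, mul_div_assoc', div_lt_iff₀ (by positivity)]
      push_cast
      have hN0 : (0 : ℝ) ≤ N := Nat.cast_nonneg N
      nlinarith
    rw [lintegral_const_mul' _ _ ENNReal.ofReal_ne_top, lintegral_scale hu.1 hp,
      ← ENNReal.ofReal_mul (by positivity)]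
    refine ENNReal.ofReal_le_ofReal ?_
    rw [hcard, hN, treeBound]
    simp only [Nat.add_sub_cancel, show N + 1 + 1 - 2 = N by omega]
    rw [hcard, hN] at hp
    rw [mul_div_assoc', div_le_iff₀ (by linarith)]
    -- The constant `θ` is chosen for this inequality, which closes the induction and is an equality
    -- at `N = 0`.
    have key : β * (N + 1) ≤ θ * ((N : ℝ) + 1 - ((N + 1 + 1 : ℕ) : ℝ) * (β / (8 * Real.pi))) := by
      have e : θ * ((N : ℝ) + 1 - ((N + 1 + 1 : ℕ) : ℝ) * (β / (8 * Real.pi))) =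
          β * ((4 * Real.pi * (N + 1) - (N + 2) * β / 2) / (4 * Real.pi - β)) := by
        rw [hθdef]
        push_cast
        field_simp
        ring
      rw [e]
      refine mul_le_mul_of_nonneg_left ?_ hβ.le
      rw [le_div_iff₀ hd]
      have hN0 : (0 : ℝ) ≤ N := Nat.cast_nonneg N
      nlinarith
    have hQ : 0 ≤ θ ^ N * ((N : ℝ) + 2) ^ N * u ^ (N + 1) := by
      have := hu.1
      positivity
    have := mul_le_mul_of_nonneg_right key hQ
    push_cast at this ⊢
    rw [show (N : ℝ) + 1 + 1 = N + 2 by ring] at this ⊢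
    calc _ = β * (N + 1) * (θ ^ N * ((N : ℝ) + 2) ^ N * u ^ (N + 1)) := by ring
      _ ≤ _ := this
      _ = _ := by ring

end Marginals

/-! ### The Bessel kernel as a superposition of slices; the limit of the cutoff potentials. -/

section Bessel

theorem hasDerivAt_heatTime {u : ℝ} (hu : u < 1) : HasDerivAt heatTime (1 - u)⁻¹ u := by
  have h := (((hasDerivAt_id u).const_sub 1).log (sub_pos.2 hu).ne').neg
  refine h.congr_deriv ?_
  simp [neg_div]

/-- By symmetry `K₀(w)` is half the integral of `exp (-w cosh y)` over the line. With `w = √m r` and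
`y = log (2 √m τ / r)` the exponent becomes `-mτ - r² / (4τ)` and `dy = dτ / τ`. Then `τ = heatTime
u` turns `exp (-mτ) dτ` into `(1 - u)^(m - 1) du`. -/
theorem besselKZero_eq {m r : ℝ} (hm : 0 < m) (hr : 0 < r) :
    besselKZero (Real.sqrt m * r) = 1 / 2 * ∫ u in Set.Ioo (0 : ℝ) 1,
      (1 - u) ^ (m - 1) * ((heatTime u)⁻¹ * Real.exp (-(r ^ 2 / (4 * heatTime u)))) := by
  have hsm : 0 < Real.sqrt m := Real.sqrt_pos.2 hm
  have hc : 0 < 2 * Real.sqrt m / r := by positivity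
  have h1 := integral_comp_abs (f := fun y => Real.exp (-(Real.sqrt m * r * Real.cosh y)))
  simp only [Real.cosh_abs] at h1
  have himage : (fun u => Real.log (2 * Real.sqrt m / r * heatTime u)) '' Set.Ioo 0 1 =
      Set.univ := by
    refine Set.eq_univ_of_forall fun y => ?_
    have ht : 0 < (2 * Real.sqrt m / r)⁻¹ * Real.exp y := by positivity
    refine ⟨1 - Real.exp (-((2 * Real.sqrt m / r)⁻¹ * Real.exp y)), ⟨?_, ?_⟩, ?_⟩
    · rw [sub_pos, Real.exp_lt_one_iff]
      linarith
    · linarith [Real.exp_pos (-((2 * Real.sqrt m / r)⁻¹ * Real.exp y))]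
    · simp only [heatTime, sub_sub_cancel, Real.log_exp, neg_neg]
      rw [mul_inv_cancel_left₀ hc.ne', Real.log_exp]
  have hinj : Set.InjOn (fun u => Real.log (2 * Real.sqrt m / r * heatTime u)) (Set.Ioo 0 1) := by
    intro u hu v hv huv
    have h2 := Real.log_injOn_pos (mul_pos hc (heatTime_pos hu.1 hu.2))
      (mul_pos hc (heatTime_pos hv.1 hv.2)) huv
    have h3 := neg_injective (mul_left_cancel₀ hc.ne' h2)
    have h4 := Real.log_injOn_pos (sub_pos.2 hu.2 : (0 : ℝ) < 1 - u)
      (sub_pos.2 hv.2 : (0 : ℝ) < 1 - v) h3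
    linarith
  have hderiv : ∀ u ∈ Set.Ioo (0 : ℝ) 1, HasDerivWithinAt
      (fun u => Real.log (2 * Real.sqrt m / r * heatTime u))
      ((heatTime u)⁻¹ * (1 - u)⁻¹) (Set.Ioo 0 1) u := by
    intro u hu
    have hτ := heatTime_pos hu.1 hu.2
    refine (((hasDerivAt_heatTime hu.2).const_mul _).log
      (mul_pos hc hτ).ne').hasDerivWithinAt.congr_deriv ?_
    field_simp
  have h2 := integral_image_eq_integral_abs_deriv_smul measurableSet_Ioo hderiv hinj
    (fun y => Real.exp (-(Real.sqrt m * r * Real.cosh y)))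
  rw [himage, Measure.restrict_univ, h1] at h2
  rw [besselKZero, ← mul_right_inj' (two_ne_zero' ℝ), h2, ← mul_assoc]
  norm_num only [one_mul]
  refine setIntegral_congr_fun measurableSet_Ioo fun u hu => ?_
  have hτ := heatTime_pos hu.1 hu.2
  have hu1 : 0 < 1 - u := sub_pos.2 hu.2
  simp only [smul_eq_mul]
  rw [abs_of_nonneg (by positivity), Real.cosh_eq, Real.exp_neg (Real.log _),
    Real.exp_log (mul_pos hc hτ)]
  have h3 : -(Real.sqrt m * r * ((2 * Real.sqrt m / r * heatTime u +
      (2 * Real.sqrt m / r * heatTime u)⁻¹) / 2)) =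
      -(heatTime u * m) + -(r ^ 2 / (4 * heatTime u)) := by
    have : Real.sqrt m * Real.sqrt m = m := Real.mul_self_sqrt hm.le
    field_simp
    rw [show Real.sqrt m ^ 2 = m by rw [sq, this]]
    ring
  have h4 : Real.exp (-(heatTime u * m)) = (1 - u) ^ (m - 1) * (1 - u) := by
    rw [Real.rpow_sub_one hu1.ne', div_mul_cancel₀ _ hu1.ne', Real.rpow_def_of_pos hu1, heatTime]
    ring_nf
  rw [h3, Real.exp_add, h4]
  field_simp

/-- The weight of the slices in the resolvent kernel of mass `m`. -/
noncomputable def massWeight (m u : ℝ) : ℝ := (1 - u) ^ (m - 1)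

theorem massWeight_one (u : ℝ) : massWeight 1 u = 1 := by simp [massWeight]

theorem continuousOn_massWeight (m : ℝ) : ContinuousOn (massWeight m) (Set.Ioo 0 1) := by
  intro u hu
  refine ContinuousAt.continuousWithinAt ?_
  refine ContinuousAt.rpow_const (by fun_prop) (Or.inl (sub_pos.2 hu.2).ne')

theorem isWeight_massWeight {m : ℝ} (hm : 1 ≤ m) : IsWeight (massWeight m) where
  continuousOn := continuousOn_massWeight m
  nonneg _ hu := Real.rpow_nonneg (sub_pos.2 hu.2).le _
  le_one _ hu := Real.rpow_le_one (sub_pos.2 hu.2).le (by linarith [hu.1]) (by linarith)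

/-- This is the weight of a cutoff potential. That it lies in `[0, 1]` for every `m ≥ 1` is the
source of uniformity in the scale function and the cutoff. -/
theorem isWeight_one_sub_massWeight {m : ℝ} (hm : 1 ≤ m) :
    IsWeight fun u => 1 - massWeight m u where
  continuousOn := continuousOn_const.sub (continuousOn_massWeight m)
  nonneg u hu := sub_nonneg.2 ((isWeight_massWeight hm).le_one u hu)
  le_one u hu := sub_le_self _ ((isWeight_massWeight hm).nonneg u hu)

theorem mul_resolventKernel_eq_pot (β : ℝ) {m : ℝ} (hm : 0 < m) {x : Plane} (hx : x ≠ 0) :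
    β * resolventKernel m x = pot β (massWeight m) 1 x := by
  rw [resolventKernel, besselKZero_eq hm (norm_pos_iff.2 hx), pot,
    intervalIntegral.integral_of_le zero_le_one, integral_Ioc_eq_integral_Ioo, ← mul_assoc,
    ← mul_assoc, ← integral_const_mul]
  refine setIntegral_congr_fun measurableSet_Ioo fun u hu => ?_
  have hτ := heatTime_pos hu.1 hu.2
  simp only [slice, heat, massWeight]
  field_simp
  ring

theorem yukawa_eq_pot (β : ℝ) {x : Plane} (hx : x ≠ 0) :
    yukawa β x = pot β (massWeight 1) 1 x :=
  mul_resolventKernel_eq_pot β zero_lt_one hx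

theorem IsScaleFunction.one_le {κ : ℝ → ℝ} (hκ : IsScaleFunction κ) {t₀ : ℝ} (ht₀ : t₀ ≤ 0) :
    1 ≤ κ t₀ := by
  have := hκ.antitoneOn (Set.mem_Iic.2 ht₀) (Set.mem_Iic.2 le_rfl) ht₀
  rwa [hκ.map_zero] at this

theorem yukawaCutoff_eq_pot {β : ℝ} (hβ : 0 ≤ β) {κ : ℝ → ℝ} (hκ : IsScaleFunction κ) {t₀ : ℝ}
    (ht₀ : t₀ ≤ 0) {x : Plane} (hx : x ≠ 0) :
    yukawaCutoff β κ t₀ x = pot β (fun u => 1 - massWeight (κ t₀) u) 1 x := by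
  have hm := hκ.one_le ht₀
  rw [yukawaCutoff, if_neg hx, hκ.map_zero, mul_resolventKernel_eq_pot β zero_lt_one hx,
    mul_resolventKernel_eq_pot β (zero_lt_one.trans_le hm) hx, pot, pot, pot,
    ← intervalIntegral.integral_sub (intervalIntegrable_slice hβ (isWeight_massWeight le_rfl) hx)
      (intervalIntegrable_slice hβ (isWeight_massWeight hm) hx)]
  refine intervalIntegral.integral_congr fun u _ => ?_
  simp only [slice, massWeight_one]
  ring

theorem tendsto_besselKZero : Tendsto besselKZero atTop (𝓝 0) := by
  have hint : IntegrableOn (fun u : ℝ => Real.exp (-(1 / 2) * u)) (Set.Ioi 0) :=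
    exp_neg_integrableOn_Ioi 0 (by norm_num)
  have hbound : ∀ w : ℝ, 1 ≤ w → besselKZero w ≤
      Real.exp (-(w / 2)) * ∫ u in Set.Ioi (0 : ℝ), Real.exp (-(1 / 2) * u) := by
    intro w hw
    rw [← integral_const_mul]
    refine integral_mono_of_nonneg (Eventually.of_forall fun u => Real.exp_nonneg _)
      (hint.const_mul _) ?_
    filter_upwards [ae_restrict_mem measurableSet_Ioi] with u hu
    rw [← Real.exp_add]
    refine Real.exp_le_exp.2 ?_
    have hu0 : 0 < u := hu
    -- The `1` yields the decay `exp (-w / 2)`; the `u`, with `w ≥ 1`, keeps the integral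
    -- convergent.
    have h1 : (1 + u) / 2 ≤ Real.cosh u := by
      rw [Real.cosh_eq]
      linarith [Real.add_one_le_exp u, Real.exp_pos (-u)]
    nlinarith
  refine squeeze_zero' (Eventually.of_forall fun w => integral_nonneg fun u => Real.exp_nonneg _)
    ((eventually_ge_atTop 1).mono hbound) ?_
  generalize (∫ u in Set.Ioi (0 : ℝ), Real.exp (-(1 / 2) * u)) = C
  rw [← zero_mul C]
  refine Tendsto.mul_const _ (Real.tendsto_exp_neg_atTop_nhds_zero.comp ?_)
  exact tendsto_id.atTop_div_const two_pos

theorem tendsto_yukawaCutoff (β : ℝ) {κ : ℝ → ℝ} (hκ : IsScaleFunction κ) {x : Plane}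
    (hx : x ≠ 0) : Tendsto (fun t₀ => yukawaCutoff β κ t₀ x) atBot (𝓝 (yukawa β x)) := by
  simp only [yukawaCutoff, if_neg hx, hκ.map_zero, yukawa]
  have h1 : Tendsto (fun t₀ => resolventKernel (κ t₀) x) atBot (𝓝 0) := by
    rw [← mul_zero (1 / (2 * Real.pi))]
    refine Tendsto.const_mul _ (tendsto_besselKZero.comp ?_)
    exact ((Real.tendsto_sqrt_atTop.comp hκ.tendsto_atBot).atTop_mul_const (norm_pos_iff.2 hx))
  simpa using (h1.const_mul β).const_sub (β * resolventKernel 1 x)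

theorem measurable_besselKZero : Measurable besselKZero := by
  have h : StronglyMeasurable fun p : ℝ × ℝ => Real.exp (-(p.1 * Real.cosh p.2)) := by
    have : Measurable fun p : ℝ × ℝ => Real.exp (-(p.1 * Real.cosh p.2)) := by fun_prop
    exact this.stronglyMeasurable
  exact h.integral_prod_right'.measurable

theorem measurable_resolventKernel (m : ℝ) : Measurable (resolventKernel m) := by
  unfold resolventKernel
  exact (measurable_besselKZero.comp (by fun_prop)).const_mul _

theorem measurable_yukawa (β : ℝ) : Measurable (yukawa β) :=
  (measurable_resolventKernel 1).const_mul β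

theorem measurable_yukawaCutoff (β : ℝ) (κ : ℝ → ℝ) (t₀ : ℝ) :
    Measurable (yukawaCutoff β κ t₀) :=
  Measurable.ite (measurableSet_singleton 0) measurable_const
    (((measurable_resolventKernel _).const_mul β).sub ((measurable_resolventKernel _).const_mul β))

end Bessel

/-! ### The exponential of a power series. -/

section Exponential

/-- A recursion that characterizes the coefficients of the exponential of a power series. -/
theorem hasSum_exp_of_recursion {q Z : ℕ → ℂ} {R : ℝ} (hq0 : q 0 = 0) (hZ0 : Z 0 = 1)
    (hrec : ∀ n : ℕ, ((n : ℂ) + 1) * Z (n + 1) =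
      ∑ k ∈ Finset.range (n + 1), ((k : ℂ) + 1) * q (k + 1) * Z (n - k))
    (hq : ∀ z : ℂ, ‖z‖ < R → Summable fun n => ‖q n * z ^ n‖) {z : ℂ} (hz : ‖z‖ < R) :
    HasSum (fun n => Z n * z ^ n) (Complex.exp (∑' n, q n * z ^ n)) := by
  have hR : 0 < R := (norm_nonneg z).trans_lt hz
  let Q := FormalMultilinearSeries.ofScalars ℂ q
  have hQ : ∀ n (z : ℂ), (Q n fun _ => z) = q n * z ^ n := fun n z => by
    simp [Q, mul_comm]
  have hrad : ENNReal.ofReal R ≤ Q.radius := by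
    refine ENNReal.le_of_forall_nnreal_lt fun r hr => ?_
    refine Q.le_radius_of_summable_norm ?_
    have hr' : ‖((r : ℝ) : ℂ)‖ < R := by
      rw [Complex.norm_real, Real.norm_of_nonneg r.coe_nonneg]
      exact (ENNReal.lt_ofReal_iff_toReal_lt ENNReal.coe_ne_top).1 hr
    refine (hq _ hr').of_nonneg_of_le (fun n => by positivity) fun n => ?_
    rw [norm_mul, norm_pow, Complex.norm_real, Real.norm_of_nonneg r.coe_nonneg]
    refine mul_le_mul_of_nonneg_right ?_ (by positivity)
    simp [Q]
  have hps : HasFPowerSeriesOnBall Q.sum Q 0 (ENNReal.ofReal R) :=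
    (Q.hasFPowerSeriesOnBall ((ENNReal.ofReal_pos.2 hR).trans_le hrad)).mono
      (ENNReal.ofReal_pos.2 hR) hrad
  have hsum : Q.sum = fun z => ∑' n, q n * z ^ n := by
    ext z
    simp only [FormalMultilinearSeries.sum, hQ]
  have hdiff : DifferentiableOn ℂ Q.sum (Metric.ball 0 R) := by
    have := hps.differentiableOn
    rwa [Metric.eball_ofReal] at this
  have hpcoeff : ∀ n, iteratedDeriv n Q.sum 0 = n.factorial * q n := by
    intro n
    have := hps.factorial_smul (1 : ℂ) n
    rw [hQ] at this
    rw [iteratedDeriv_eq_iteratedFDeriv, ← this]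
    simp
  have hfdiff : DifferentiableOn ℂ (fun z => Complex.exp (Q.sum z)) (Metric.ball 0 R) :=
    hdiff.cexp
  have hball : Metric.ball (0 : ℂ) R ∈ 𝓝 0 := Metric.ball_mem_nhds 0 hR
  have hpan : AnalyticAt ℂ Q.sum 0 := hps.analyticAt
  have hfan : AnalyticAt ℂ (fun z => Complex.exp (Q.sum z)) 0 := hpan.cexp
  -- For `f = exp Q`, Leibniz' rule applied to `f' = Q' f` gives the Taylor coefficients of `f` the
  -- recursion of `Z`.
  have hderiv : deriv (fun z => Complex.exp (Q.sum z)) =ᶠ[𝓝 0]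
      fun z => deriv Q.sum z * Complex.exp (Q.sum z) := by
    filter_upwards [hball] with w hw
    have := ((hdiff.differentiableAt (Metric.isOpen_ball.mem_nhds hw)).hasDerivAt.cexp).deriv
    rw [this, mul_comm]
  have hfcoeff : ∀ n, iteratedDeriv n (fun z => Complex.exp (Q.sum z)) 0 = n.factorial * Z n := by
    intro n
    induction n using Nat.strong_induction_on with
    | _ n ih =>
      cases n with
      | zero =>
        have h0 : Q.sum 0 = 0 := by
          rw [hsum]
          refine (tsum_eq_single 0 fun n hn => by simp [hn]).trans (by simp [hq0])
        simp [h0, hZ0]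
      | succ n =>
        rw [iteratedDeriv_succ', hderiv.iteratedDeriv_eq,
          iteratedDeriv_fun_mul hpan.deriv.contDiffAt hfan.contDiffAt]
        have hterm : ∀ i ∈ Finset.range (n + 1), (n.choose i : ℂ) *
            iteratedDeriv i (deriv Q.sum) 0 *
            iteratedDeriv (n - i) (fun z => Complex.exp (Q.sum z)) 0 =
            n.factorial * (((i : ℂ) + 1) * q (i + 1) * Z (n - i)) := by
          intro i hi
          have hin : i ≤ n := Nat.lt_succ_iff.1 (Finset.mem_range.1 hi)
          rw [← iteratedDeriv_succ', hpcoeff, ih (n - i) (by omega),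
            ← Nat.choose_mul_factorial_mul_factorial hin, Nat.factorial_succ]
          push_cast
          ring
        rw [Finset.sum_congr rfl hterm, ← Finset.mul_sum, ← hrec, Nat.factorial_succ]
        push_cast
        ring
  -- The series with coefficients `Z` converges on the whole disc because it is the Taylor series of
  -- a function holomorphic there; no bound on `Z` is needed.
  have h := Complex.hasSum_taylorSeries_on_ball hfdiff (z := z) (by simpa using hz)
  have hterm : ∀ n : ℕ, ((n.factorial : ℂ))⁻¹ • (z - 0) ^ n •
      iteratedDeriv n (fun z => Complex.exp (Q.sum z)) 0 = Z n * z ^ n := by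
    intro n
    have : (n.factorial : ℂ) ≠ 0 := Nat.cast_ne_zero.2 n.factorial_ne_zero
    rw [hfcoeff n, sub_zero, smul_eq_mul, smul_eq_mul]
    field_simp
  simp only [hterm] at h
  rw [hsum] at h
  exact h

end Exponential

/-! ### Factorization of state integrals and the recursion for the partition function. -/

section Factorization

variable {X : Set Plane}

theorem restrict_configs (X : Set Plane) (n : ℕ) :
    (volume : Measure (Fin n → Plane)).restrict (configs X n) =
      Measure.pi fun _ => volume.restrict X := by
  rw [configs, volume_pi, Measure.restrict_pi_pi]

theorem measurePreserving_split {E : Type*} [MeasurableSpace E] (μ : Measure E) [SigmaFinite μ]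
    {n k l : ℕ} (e : Fin k ⊕ Fin l ≃ Fin n) :
    MeasurePreserving ((MeasurableEquiv.arrowCongr' e.symm (MeasurableEquiv.refl E)).trans
      (MeasurableEquiv.sumPiEquivProdPi fun _ => E)) (Measure.pi fun _ => μ)
      ((Measure.pi fun _ => μ).prod (Measure.pi fun _ => μ)) :=
  (measurePreserving_sumPiEquivProdPi fun _ => μ).comp
    (measurePreserving_arrowCongr' (fun _ => μ) (fun _ => μ) e.symm (MeasurableEquiv.refl E)
      fun _ => MeasurePreserving.id _)

theorem integral_configs_mul {n k l : ℕ} (e : Fin k ⊕ Fin l ≃ Fin n)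
    (F : (Fin k → Plane) → ℝ) (H : (Fin l → Plane) → ℝ) :
    ∫ x in configs X n, F (fun i => x (e (Sum.inl i))) * H (fun i => x (e (Sum.inr i))) =
      (∫ x in configs X k, F x) * ∫ x in configs X l, H x := by
  rw [restrict_configs, restrict_configs, restrict_configs, ← integral_prod_mul]
  exact (measurePreserving_split (volume.restrict X) e).integral_comp'
    (fun z : (Fin k → Plane) × (Fin l → Plane) => F z.1 * H z.2)

theorem integrableOn_configs_mul {n k l : ℕ} (e : Fin k ⊕ Fin l ≃ Fin n)
    {F : (Fin k → Plane) → ℝ} {H : (Fin l → Plane) → ℝ} (hF : IntegrableOn F (configs X k))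
    (hH : IntegrableOn H (configs X l)) :
    IntegrableOn (fun x : Fin n → Plane => F (fun i => x (e (Sum.inl i))) *
      H (fun i => x (e (Sum.inr i)))) (configs X n) := by
  rw [IntegrableOn, restrict_configs] at *
  exact (measurePreserving_split (volume.restrict X) e).integrable_comp_of_integrable
    (hF.mul_prod hH)

theorem stateIntegral_mul {n k l : ℕ} (e : Fin k ⊕ Fin l ≃ Fin n)
    (F : (Fin k → ℤˣ) → (Fin k → Plane) → ℝ) (H : (Fin l → ℤˣ) → (Fin l → Plane) → ℝ) :
    stateIntegral X n (fun σ x => F (fun i => σ (e (Sum.inl i))) (fun i => x (e (Sum.inl i))) *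
      H (fun i => σ (e (Sum.inr i))) (fun i => x (e (Sum.inr i)))) =
      stateIntegral X k F * stateIntegral X l H := by
  have hn : n = k + l := by
    have := Fintype.card_congr e
    simpa using this.symm
  simp only [stateIntegral, integral_configs_mul e]
  have h := Fintype.sum_equiv ((Equiv.arrowCongr e.symm (Equiv.refl ℤˣ)).trans
    (Equiv.sumArrowEquivProdArrow (Fin k) (Fin l) ℤˣ))
    (fun σ : Fin n → ℤˣ => (∫ x in configs X k, F (fun i => σ (e (Sum.inl i))) x) *
      ∫ x in configs X l, H (fun i => σ (e (Sum.inr i))) x)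
    (fun p => (∫ x in configs X k, F p.1 x) * ∫ x in configs X l, H p.2 x) (fun σ => rfl)
  rw [h, Fintype.sum_prod_type]
  dsimp only
  rw [← Finset.sum_mul_sum, hn, pow_add]
  ring

theorem stateIntegral_finsetSum {κ : Type*} {n : ℕ} (T : Finset κ)
    (F : κ → (Fin n → ℤˣ) → (Fin n → Plane) → ℝ)
    (hF : ∀ c ∈ T, ∀ σ, IntegrableOn (F c σ) (configs X n)) :
    stateIntegral X n (fun σ x => ∑ c ∈ T, F c σ x) = ∑ c ∈ T, stateIntegral X n (F c) := by
  simp only [stateIntegral]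
  rw [← Finset.mul_sum, Finset.sum_comm]
  congr 1
  exact Finset.sum_congr rfl fun σ _ => integral_finsetSum _ fun c hc => hF c hc σ

theorem connSum_eq_ursell (v : Plane → ℝ) {n k : ℕ} (σ : Fin n → ℤˣ) (x : Fin n → Plane)
    {J : Finset (Fin n)} (hJ : J.card = k) :
    connSum (fun i j => Real.exp (-pairInteraction v σ x i j) - 1) J =
      ursell v (fun i => σ (J.orderEmbOfFin hJ i)) (fun i => x (J.orderEmbOfFin hJ i)) := by
  rw [ursell_eq]
  conv_lhs => rw [← Finset.map_orderEmbOfFin_univ J hJ]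
  exact connSum_map _ _ _

theorem pairProd_eq_boltzmann (v : Plane → ℝ) {n k : ℕ} (σ : Fin n → ℤˣ) (x : Fin n → Plane)
    {J : Finset (Fin n)} (hJ : J.card = k) :
    pairProd (fun i j => Real.exp (-pairInteraction v σ x i j) - 1) J =
      boltzmann v (fun i => σ (J.orderEmbOfFin hJ i)) (fun i => x (J.orderEmbOfFin hJ i)) := by
  rw [boltzmann_eq]
  conv_lhs => rw [← Finset.map_orderEmbOfFin_univ J hJ]
  exact pairProd_map _ _ _

theorem connSum_mul_pairProd_eq (v : Plane → ℝ) {n k l : ℕ} {J : Finset (Fin n)}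
    (hk : J.card = k) (hl : Jᶜ.card = l) (σ : Fin n → ℤˣ) (x : Fin n → Plane) :
    connSum (fun i j => Real.exp (-pairInteraction v σ x i j) - 1) J *
      pairProd (fun i j => Real.exp (-pairInteraction v σ x i j) - 1) (Finset.univ \ J) =
    ursell v (fun i => σ (finSumEquivOfFinset hk hl (Sum.inl i)))
      (fun i => x (finSumEquivOfFinset hk hl (Sum.inl i))) *
    boltzmann v (fun i => σ (finSumEquivOfFinset hk hl (Sum.inr i)))
      (fun i => x (finSumEquivOfFinset hk hl (Sum.inr i))) := by
  rw [connSum_eq_ursell v σ x hk, ← Finset.compl_eq_univ_sdiff, pairProd_eq_boltzmann v σ x hl]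
  simp only [finSumEquivOfFinset_inl, finSumEquivOfFinset_inr]

theorem boltzmann_succ (v : Plane → ℝ) {n : ℕ} (σ : Fin (n + 1) → ℤˣ) (x : Fin (n + 1) → Plane) :
    boltzmann v σ x = ∑ J : Finset (Fin (n + 1)) with 0 ∈ J,
      connSum (fun i j => Real.exp (-pairInteraction v σ x i j) - 1) J *
      pairProd (fun i j => Real.exp (-pairInteraction v σ x i j) - 1) (Finset.univ \ J) := by
  rw [boltzmann_eq, pairProd_eq_sum_component _ (Finset.mem_univ 0), Finset.powerset_univ]

variable {v : Plane → ℝ}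

theorem integrableOn_connSum_mul_pairProd {n : ℕ}
    (hU : ∀ (n : ℕ) (σ : Fin n → ℤˣ), IntegrableOn (fun x => ursell v σ x) (configs X n))
    {J : Finset (Fin n)}
    (hB : ∀ σ : Fin Jᶜ.card → ℤˣ, IntegrableOn (fun x => boltzmann v σ x) (configs X Jᶜ.card))
    (σ : Fin n → ℤˣ) : IntegrableOn (fun x =>
      connSum (fun i j => Real.exp (-pairInteraction v σ x i j) - 1) J *
      pairProd (fun i j => Real.exp (-pairInteraction v σ x i j) - 1) (Finset.univ \ J))
      (configs X n) := by
  simp_rw [connSum_mul_pairProd_eq v rfl rfl]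
  exact integrableOn_configs_mul (finSumEquivOfFinset rfl rfl) (hU _ _) (hB _)

/-- The expansion by the cluster of particle `0` writes the Boltzmann factor as a sum of products of
an Ursell function and a Boltzmann factor of fewer particles, in separate variables. Integrability
thus passes from the Ursell functions to the Boltzmann factors, with no stability bound for the full
potential. -/
theorem integrableOn_boltzmann (hX : volume X ≠ ⊤)
    (hU : ∀ (n : ℕ) (σ : Fin n → ℤˣ), IntegrableOn (fun x => ursell v σ x) (configs X n))
    (n : ℕ) (σ : Fin n → ℤˣ) : IntegrableOn (fun x => boltzmann v σ x) (configs X n) := by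
  induction n using Nat.strong_induction_on with
  | _ n ih =>
    cases n with
    | zero =>
      have h1 : (fun x => boltzmann v σ x) = fun _ => 1 := by
        ext x
        simp [boltzmann]
      have : IsFiniteMeasure (volume.restrict X) :=
        ⟨by rw [Measure.restrict_apply_univ]; exact hX.lt_top⟩
      rw [h1, IntegrableOn, restrict_configs]
      exact integrable_const 1
    | succ n =>
      simp_rw [boltzmann_succ]
      refine integrable_finsetSum _ fun J hJ => ?_
      have h0 : (0 : Fin (n + 1)) ∈ J := (Finset.mem_filter.1 hJ).2
      have hlt : Jᶜ.card < n + 1 := by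
        rw [Finset.card_compl, Fintype.card_fin]
        have : 0 < J.card := Finset.card_pos.2 ⟨0, h0⟩
        omega
      exact integrableOn_connSum_mul_pairProd hU (fun τ => ih _ hlt τ) σ

/-- There are `n.choose k` clusters of size `k + 1` that contain particle `0`, and each contributes
the same product of integrals. -/
theorem stateIntegral_boltzmann_succ
    (hU : ∀ (n : ℕ) (σ : Fin n → ℤˣ), IntegrableOn (fun x => ursell v σ x) (configs X n))
    (hB : ∀ (n : ℕ) (σ : Fin n → ℤˣ), IntegrableOn (fun x => boltzmann v σ x) (configs X n))
    (n : ℕ) :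
    stateIntegral X (n + 1) (fun σ x => boltzmann v σ x) =
      ∑ k ∈ Finset.range (n + 1), (n.choose k : ℝ) *
        (stateIntegral X (k + 1) (fun σ x => ursell v σ x) *
          stateIntegral X (n - k) (fun σ x => boltzmann v σ x)) := by
  simp_rw [boltzmann_succ v (n := n)]
  rw [stateIntegral_finsetSum _ (fun (J : Finset (Fin (n + 1))) σ x =>
      connSum (fun i j => Real.exp (-pairInteraction v σ x i j) - 1) J *
      pairProd (fun i j => Real.exp (-pairInteraction v σ x i j) - 1) (Finset.univ \ J))
      fun J _ σ => integrableOn_connSum_mul_pairProd hU (fun τ => hB _ τ) σ]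
  have hterm : ∀ J : Finset (Fin (n + 1)), stateIntegral X (n + 1) (fun σ x =>
      connSum (fun i j => Real.exp (-pairInteraction v σ x i j) - 1) J *
      pairProd (fun i j => Real.exp (-pairInteraction v σ x i j) - 1) (Finset.univ \ J)) =
      stateIntegral X J.card (fun σ x => ursell v σ x) *
        stateIntegral X (n + 1 - J.card) (fun σ x => boltzmann v σ x) := by
    intro J
    have hl : Jᶜ.card = n + 1 - J.card := by rw [Finset.card_compl, Fintype.card_fin]
    simp_rw [connSum_mul_pairProd_eq v rfl hl]
    exact stateIntegral_mul (finSumEquivOfFinset rfl hl) _ _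
  simp_rw [hterm]
  have h0 : (0 : Fin (n + 1)) ∉ Finset.univ.erase (0 : Fin (n + 1)) := Finset.notMem_erase _ _
  have huniv : (Finset.univ : Finset (Finset (Fin (n + 1)))) =
      (insert 0 (Finset.univ.erase (0 : Fin (n + 1)))).powerset := by
    rw [Finset.insert_erase (Finset.mem_univ _), Finset.powerset_univ]
  rw [huniv, sum_powerset_insert_mem h0]
  have hcard : ∀ J ∈ (Finset.univ.erase (0 : Fin (n + 1))).powerset,
      stateIntegral X (insert 0 J).card (fun σ x => ursell v σ x) *
        stateIntegral X (n + 1 - (insert 0 J).card) (fun σ x => boltzmann v σ x) =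
      stateIntegral X (J.card + 1) (fun σ x => ursell v σ x) *
        stateIntegral X (n - J.card) (fun σ x => boltzmann v σ x) := by
    intro J hJ
    have : (insert 0 J).card = J.card + 1 :=
      Finset.card_insert_of_notMem fun h => h0 (Finset.mem_powerset.1 hJ h)
    rw [this, Nat.add_sub_add_right]
  rw [Finset.sum_congr rfl hcard, Finset.sum_powerset_apply_card (fun k =>
    stateIntegral X (k + 1) (fun σ x => ursell v σ x) *
        stateIntegral X (n - k) (fun σ x => boltzmann v σ x))]
  simp [Finset.card_erase_of_mem]

theorem partitionCoeff_zero : partitionCoeff v X 0 = 1 := by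
  have h : ∀ σ : Fin 0 → ℤˣ, ∫ x in configs X 0, boltzmann v σ x = 1 := by
    intro σ
    have h1 : (fun x => boltzmann v σ x) = fun _ => 1 := by
      ext x
      simp [boltzmann]
    rw [h1, configs]
    simp [volume_pi, measureReal_def, Measure.pi_pi]
  simp [partitionCoeff, stateIntegral, h]

theorem mayerCoeff_zero : mayerCoeff v X 0 = 0 := by
  have h : ∀ (σ : Fin 0 → ℤˣ) x, ursell v σ x = 0 := by
    intro σ x
    rw [ursell_eq, Finset.univ_eq_empty, connSum_empty]
  simp [mayerCoeff, stateIntegral, h]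

theorem partitionCoeff_succ (hX0 : volume X ≠ 0) (hX : volume X ≠ ⊤)
    (hU : ∀ (n : ℕ) (σ : Fin n → ℤˣ), IntegrableOn (fun x => ursell v σ x) (configs X n))
    (n : ℕ) :
    ((n : ℝ) + 1) * partitionCoeff v X (n + 1) = ∑ k ∈ Finset.range (n + 1),
      ((k : ℝ) + 1) * ((volume X).toReal * mayerCoeff v X (k + 1)) *
        partitionCoeff v X (n - k) := by
  have hV : (volume X).toReal ≠ 0 := ENNReal.toReal_ne_zero.2 ⟨hX0, hX⟩
  rw [partitionCoeff, stateIntegral_boltzmann_succ hU (integrableOn_boltzmann hX hU), ← mul_assoc,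
    Finset.mul_sum]
  refine Finset.sum_congr rfl fun k hk => ?_
  have hkn : k ≤ n := Nat.lt_succ_iff.1 (Finset.mem_range.1 hk)
  rw [mayerCoeff, partitionCoeff, Nat.cast_choose ℝ hkn, Nat.factorial_succ, Nat.factorial_succ]
  have := Nat.factorial_ne_zero n
  have := Nat.factorial_ne_zero k
  have := Nat.factorial_ne_zero (n - k)
  push_cast
  field_simp

theorem hasSum_partitionCoeff (hX0 : volume X ≠ 0) (hX : volume X ≠ ⊤)
    (hU : ∀ (n : ℕ) (σ : Fin n → ℤˣ), IntegrableOn (fun x => ursell v σ x) (configs X n))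
    {R : ℝ} (hR : ∀ z : ℂ, ‖z‖ < R → Summable fun n : ℕ => ‖(mayerCoeff v X n : ℂ) * z ^ n‖)
    {z : ℂ} (hz : ‖z‖ < R) :
    HasSum (fun n : ℕ => (partitionCoeff v X n : ℂ) * z ^ n)
      (Complex.exp (((volume X).toReal : ℂ) * ∑' n : ℕ, (mayerCoeff v X n : ℂ) * z ^ n)) := by
  have h := hasSum_exp_of_recursion (q := fun n => ((volume X).toReal : ℂ) * mayerCoeff v X n)
    (Z := fun n => (partitionCoeff v X n : ℂ)) (R := R) (by simp [mayerCoeff_zero])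
    (by simp [partitionCoeff_zero]) (fun n => by
      have := congrArg (fun r : ℝ => (r : ℂ)) (partitionCoeff_succ hX0 hX hU n)
      push_cast at this
      exact this) (fun w hw => by
      simp_rw [mul_assoc, norm_mul ((volume X).toReal : ℂ)]
      exact (hR w hw).mul_left _) hz
  simp_rw [mul_assoc, tsum_mul_left] at h
  exact h

end Factorization

/-! ### Bounds on the Mayer coefficients, convergence, and removal of the cutoff. -/

section Convergence

/-- Coincidence of two positions is a proper linear subspace. Hence the values of the potentials at
`x = 0` play no role in the integrals. -/
theorem ae_injective (n : ℕ) : ∀ᵐ x : Fin n → Plane, Function.Injective x := by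
  have h : ∀ p : Fin n × Fin n, p.1 ≠ p.2 → ∀ᵐ x : Fin n → Plane, x p.1 ≠ x p.2 := by
    rintro ⟨i, j⟩ hij
    let S : Submodule ℝ (Fin n → Plane) := LinearMap.ker
      ((LinearMap.proj i : (Fin n → Plane) →ₗ[ℝ] Plane) - LinearMap.proj j)
    have hS : S ≠ ⊤ := by
      intro h
      obtain ⟨y, hy⟩ := exists_ne (0 : Plane)
      have h1 : Pi.single i y ∈ S := h ▸ Submodule.mem_top
      simp only [S, LinearMap.mem_ker, LinearMap.sub_apply, LinearMap.proj_apply,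
        Pi.single_eq_same, Pi.single_eq_of_ne hij.symm, sub_zero] at h1
      exact hy h1
    have h2 := Measure.addHaar_submodule (volume : Measure (Fin n → Plane)) S hS
    rw [ae_iff]
    convert h2 using 2
    ext x
    simp [S, sub_eq_zero]
  have h3 : ∀ᵐ x : Fin n → Plane, ∀ p : Fin n × Fin n, p.1 ≠ p.2 → x p.1 ≠ x p.2 := by
    rw [ae_all_iff]
    intro p
    by_cases hp : p.1 ≠ p.2
    · exact (h p hp).mono fun x hx _ => hx
    · exact Eventually.of_forall fun x hx => absurd hx hp
  filter_upwards [h3] with x hx i j hij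
  by_contra hne
  exact hx (i, j) hne hij

theorem connSum_congr {ι R : Type*} [LinearOrder ι] [CommRing R] {f g : ι → ι → R} {I : Finset ι}
    (h : ∀ p ∈ pairs I, f p.1 p.2 = g p.1 p.2) : connSum f I = connSum g I := by
  classical
  refine Finset.sum_congr rfl fun T hT => Finset.prod_congr rfl fun p hp => h p ?_
  exact Finset.mem_powerset.1 (Finset.mem_filter.1 hT).1 hp

theorem measurable_ursell {v : Plane → ℝ} (hv : Measurable v) {n : ℕ} (σ : Fin n → ℤˣ) :
    Measurable fun x => ursell v σ x := by
  unfold ursell pairInteraction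
  refine Finset.measurable_fun_sum _ fun G _ => Finset.measurable_fun_prod _ fun p _ => ?_
  have : Measurable fun x : Fin n → Plane => v (x p.1 - x p.2) := hv.comp (by fun_prop)
  fun_prop

theorem tendsto_ursell {l : Filter ℝ} {v : ℝ → Plane → ℝ} {w : Plane → ℝ}
    (hvw : ∀ x, x ≠ 0 → Tendsto (fun t => v t x) l (𝓝 (w x))) {n : ℕ} (σ : Fin n → ℤˣ)
    {x : Fin n → Plane} (hx : Function.Injective x) :
    Tendsto (fun t => ursell (v t) σ x) l (𝓝 (ursell w σ x)) := by
  unfold ursell pairInteraction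
  refine tendsto_finsetSum _ fun G _ => tendsto_finsetProd _ fun p hp => ?_
  simp only [Finset.mem_filter] at hp
  have hne : x p.1 - x p.2 ≠ 0 := sub_ne_zero.2 (hx.ne hp.2.1.ne)
  exact ((Real.continuous_exp.tendsto _).comp ((hvw _ hne).const_mul _).neg).sub_const 1

variable {β : ℝ} {X : Set Plane}

theorem enorm_ursell_le (hβ : 0 ≤ β) {g : ℝ → ℝ} (hg : IsWeight g) {v : Plane → ℝ}
    (hv : ∀ x, x ≠ 0 → v x = pot β g 1 x) {n : ℕ} (σ : Fin n → ℤˣ) {x : Fin n → Plane}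
    (hx : Function.Injective x) : ‖ursell v σ x‖ₑ ≤ majorant β n Finset.univ 1 x := by
  rw [ursell_eq]
  rcases (Finset.univ : Finset (Fin n)).eq_empty_or_nonempty with h | h
  · rw [h, connSum_empty]
    simp
  · have hcongr := connSum_congr (I := (Finset.univ : Finset (Fin n)))
      (f := fun i j => Real.exp (-pairInteraction v σ x i j) - 1)
      (g := fun i j => Real.exp (-(((σ i : ℤ) : ℝ) * ((σ j : ℤ) : ℝ) *
          pot β g 1 (x i - x j))) - 1) fun p hp => by
        simp only [pairInteraction, hv _ (sub_ne_zero.2 (hx.ne (ne_of_mem_pairs hp)))]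
    rw [hcongr]
    exact enorm_connSum_le hβ hg σ hx n h (by simp) ⟨zero_lt_one, le_rfl⟩

theorem setLIntegral_majorant_le (hβ : 0 < β) (hβ' : β < 4 * Real.pi) (hX : MeasurableSet X)
    (n : ℕ) : ∫⁻ x in configs X (n + 1), majorant β (n + 1) Finset.univ 1 x ≤
      volume X * ENNReal.ofReal (treeBound (4 * Real.pi * β / (4 * Real.pi - β)) (n + 1)) := by
  set c := ENNReal.ofReal (treeBound (4 * Real.pi * β / (4 * Real.pi - β)) (n + 1)) with hc
  have hS : MeasurableSet {x : Fin (n + 1) → Plane | x 0 ∈ X} := measurable_pi_apply 0 hX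
  have hmaj := measurable_majorant_right (ι := Fin (n + 1)) β (n + 1) Finset.univ 1
  have hf : Measurable ({x : Fin (n + 1) → Plane | x 0 ∈ X}.indicator
      (majorant β (n + 1) Finset.univ 1)) := hmaj.indicator hS
  -- Only particle `0` is kept in `X`; the others range over the whole plane. This gives one factor
  -- `|X|` and a bound per volume that does not depend on `X`.
  calc ∫⁻ x in configs X (n + 1), majorant β (n + 1) Finset.univ 1 x
      ≤ ∫⁻ x in {x : Fin (n + 1) → Plane | x 0 ∈ X}, majorant β (n + 1) Finset.univ 1 x :=
        lintegral_mono_set fun x hx => hx 0 (Set.mem_univ 0)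
    _ = lmarginal (fun _ => volume) Finset.univ ({x : Fin (n + 1) → Plane | x 0 ∈ X}.indicator
          (majorant β (n + 1) Finset.univ 1)) 0 := by
        rw [← lintegral_indicator hS, ← lintegral_eq_lmarginal_univ, volume_pi]
    _ = ∫⁻ y, lmarginal (fun _ => volume) (Finset.univ.erase 0)
          ({x : Fin (n + 1) → Plane | x 0 ∈ X}.indicator
          (majorant β (n + 1) Finset.univ 1)) (Function.update 0 0 y) :=
        lmarginal_erase _ hf (Finset.mem_univ 0) _
    _ ≤ ∫⁻ y, X.indicator (fun _ => c) y := by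
        refine lintegral_mono fun y => ?_
        by_cases hy : y ∈ X
        · rw [Set.indicator_of_mem hy]
          refine (lmarginal_mono (Set.indicator_le_self _ _) _).trans ?_
          have := lmarginal_majorant_le hβ hβ' (n + 1) (Finset.univ : Finset (Fin (n + 1)))
            (by simp) 0 (Finset.mem_univ 0) 1 ⟨zero_lt_one, le_rfl⟩ (Function.update 0 0 y)
          simpa using this
        · rw [Set.indicator_of_notMem hy, lmarginal]
          refine (lintegral_congr fun w => ?_).trans_le (lintegral_zero.le)
          refine Set.indicator_of_notMem ?_ _
          simpa [Function.updateFinset] using hy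
    _ = volume X * c := by rw [lintegral_indicator hX, setLIntegral_const, mul_comm]

/-- The majorants of the Mayer coefficients. -/
noncomputable def mayerBound (β : ℝ) (n : ℕ) : ℝ :=
  if n = 0 then 0 else treeBound (4 * Real.pi * β / (4 * Real.pi - β)) n / n.factorial

theorem mayerBound_nonneg (hβ : 0 < β) (hβ' : β < 4 * Real.pi) (n : ℕ) : 0 ≤ mayerBound β n := by
  unfold mayerBound
  have hd : 0 < 4 * Real.pi - β := by linarith
  split_ifs
  · exact le_rfl
  · exact div_nonneg (treeBound_nonneg (by positivity) _) (Nat.cast_nonneg _)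

theorem summable_mayerBound (hβ : 0 < β) (hβ' : β < 4 * Real.pi) {r : ℝ} (hr0 : 0 ≤ r)
    (hr : r < (4 * Real.pi - β) / (4 * Real.pi * Real.exp 1 * β)) :
    Summable fun n => mayerBound β n * r ^ n := by
  have hπ := Real.pi_pos
  have hd : 0 < 4 * Real.pi - β := by linarith
  set θ := 4 * Real.pi * β / (4 * Real.pi - β) with hθdef
  have hθ : 0 < θ := by positivity
  -- The radius in the statement is `1 / (eθ)`, and the series is compared with the geometric series
  -- of ratio `θ e r`.
  have hlt : θ * Real.exp 1 * r < 1 := by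
    rw [lt_div_iff₀ (by positivity)] at hr
    rw [hθdef, div_mul_eq_mul_div, div_mul_eq_mul_div, div_lt_one hd]
    linarith
  refine ((summable_geometric_of_lt_one (by positivity) hlt).mul_left θ⁻¹).of_nonneg_of_le
    (fun n => mul_nonneg (mayerBound_nonneg hβ hβ' n) (pow_nonneg hr0 n)) fun n => ?_
  rcases n with _ | n
  · simp [mayerBound, hθ.le]
  · rw [mayerBound, if_neg n.succ_ne_zero, ← hθdef, treeBound]
    have h1 : ((n + 1 : ℕ) : ℝ) ^ (n + 1 - 2) ≤ ((n + 1 : ℕ) : ℝ) ^ (n + 1) :=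
      pow_le_pow_right₀ (by exact_mod_cast n.succ_pos) (by omega)
    have h2 := Real.pow_div_factorial_le_exp ((n + 1 : ℕ) : ℝ) (Nat.cast_nonneg _) (n + 1)
    have h3 : Real.exp ((n + 1 : ℕ) : ℝ) = Real.exp 1 ^ (n + 1) := by
      rw [← Real.exp_nat_mul, mul_one]
    rw [h3] at h2
    have h4 : ((n + 1 : ℕ) : ℝ) ^ (n + 1 - 2) / ((n + 1).factorial : ℝ) ≤ Real.exp 1 ^ (n + 1) :=
      (div_le_div_of_nonneg_right h1 (Nat.cast_nonneg _)).trans h2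
    calc θ ^ (n + 1 - 1) * ((n + 1 : ℕ) : ℝ) ^ (n + 1 - 2) / ((n + 1).factorial : ℝ) * r ^ (n + 1)
        = θ ^ n * (((n + 1 : ℕ) : ℝ) ^ (n + 1 - 2) / ((n + 1).factorial : ℝ)) * r ^ (n + 1) := by
          rw [Nat.add_sub_cancel]; ring
      _ ≤ θ ^ n * Real.exp 1 ^ (n + 1) * r ^ (n + 1) := by gcongr
      _ = θ⁻¹ * (θ * Real.exp 1 * r) ^ (n + 1) := by
          rw [mul_pow, mul_pow, pow_succ θ]
          field_simp

section

variable {g : ℝ → ℝ} {v : Plane → ℝ}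

theorem setLIntegral_enorm_ursell_le (hβ : 0 < β) (hβ' : β < 4 * Real.pi) (hX : MeasurableSet X)
    (hg : IsWeight g) (hv : ∀ x, x ≠ 0 → v x = pot β g 1 x) {n : ℕ} (σ : Fin (n + 1) → ℤˣ) :
    ∫⁻ x in configs X (n + 1), ‖ursell v σ x‖ₑ ≤
      volume X * ENNReal.ofReal (treeBound (4 * Real.pi * β / (4 * Real.pi - β)) (n + 1)) :=
  (lintegral_mono_ae (ae_restrict_of_ae ((ae_injective (n + 1)).mono fun _ hx =>
    enorm_ursell_le hβ.le hg hv σ hx))).trans (setLIntegral_majorant_le hβ hβ' hX n)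

theorem integrableOn_ursell (hβ : 0 < β) (hβ' : β < 4 * Real.pi) (hX : MeasurableSet X)
    (hXt : volume X ≠ ⊤) (hg : IsWeight g) (hvm : Measurable v)
    (hv : ∀ x, x ≠ 0 → v x = pot β g 1 x) (n : ℕ) (σ : Fin n → ℤˣ) :
    IntegrableOn (fun x => ursell v σ x) (configs X n) := by
  refine ⟨(measurable_ursell hvm σ).aestronglyMeasurable, ?_⟩
  cases n with
  | zero =>
    have h : (fun x => ursell v σ x) = fun _ => 0 := by
      ext x
      rw [ursell_eq, Finset.univ_eq_empty, connSum_empty]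
    rw [h]
    simp [HasFiniteIntegral]
  | succ n =>
    exact (setLIntegral_enorm_ursell_le hβ hβ' hX hg hv σ).trans_lt
      (ENNReal.mul_lt_top hXt.lt_top ENNReal.ofReal_lt_top)

theorem abs_mayerCoeff_le (hβ : 0 < β) (hβ' : β < 4 * Real.pi) (hX : MeasurableSet X)
    (hX0 : volume X ≠ 0) (hXt : volume X ≠ ⊤) (hg : IsWeight g)
    (hv : ∀ x, x ≠ 0 → v x = pot β g 1 x) (n : ℕ) : |mayerCoeff v X n| ≤ mayerBound β n := by
  cases n with
  | zero => simp [mayerCoeff_zero, mayerBound]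
  | succ n =>
    have hd : 0 < 4 * Real.pi - β := by linarith
    have hθ : 0 ≤ 4 * Real.pi * β / (4 * Real.pi - β) := by positivity
    set b := treeBound (4 * Real.pi * β / (4 * Real.pi - β)) (n + 1) with hb
    have hb0 : 0 ≤ b := treeBound_nonneg hθ _
    have hV : 0 < (volume X).toReal := ENNReal.toReal_pos hX0 hXt
    have hint : ∀ σ : Fin (n + 1) → ℤˣ, |∫ x in configs X (n + 1), ursell v σ x| ≤
        (volume X).toReal * b := by
      intro σ
      have h := (enorm_integral_le_lintegral_enorm (fun x => ursell v σ x)).trans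
        (setLIntegral_enorm_ursell_le hβ hβ' hX hg hv σ)
      have h2 := ENNReal.toReal_mono
        (ENNReal.mul_lt_top hXt.lt_top ENNReal.ofReal_lt_top).ne h
      rwa [toReal_enorm, Real.norm_eq_abs, ENNReal.toReal_mul, ENNReal.toReal_ofReal hb0] at h2
    have hstate : |stateIntegral X (n + 1) fun σ x => ursell v σ x| ≤ (volume X).toReal * b := by
      rw [stateIntegral, abs_mul, abs_of_nonneg (by positivity : (0 : ℝ) ≤ (1 / 2) ^ (n + 1))]
      have h := (Finset.abs_sum_le_sum_abs (fun σ : Fin (n + 1) → ℤˣ =>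
        ∫ x in configs X (n + 1), ursell v σ x) Finset.univ).trans
        (Finset.sum_le_sum fun σ _ => hint σ)
      rw [Finset.sum_const, nsmul_eq_mul] at h
      -- The bound on the integral is the same for all charges, so their number cancels the
      -- normalization of the uniform measure.
      have hcard : ((Finset.univ : Finset (Fin (n + 1) → ℤˣ)).card : ℝ) = 2 ^ (n + 1) := by
        simp
      rw [hcard] at h
      calc _ ≤ (1 / 2 : ℝ) ^ (n + 1) * (2 ^ (n + 1) * ((volume X).toReal * b)) := by gcongr
        _ = _ := by
          rw [← mul_assoc, ← mul_pow]
          norm_num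
    have hf : (0 : ℝ) < (n + 1).factorial := by exact_mod_cast Nat.factorial_pos _
    rw [mayerCoeff, abs_mul, abs_of_nonneg (by positivity), mayerBound, if_neg n.succ_ne_zero,
      ← hb, one_div_mul_eq_div, div_le_div_iff₀ (by positivity) hf]
    calc _ ≤ (volume X).toReal * b * ((n + 1).factorial : ℝ) := by gcongr
      _ = _ := by ring

/-- The Mayer series of a gas whose potential is a superposition of slices. -/
theorem hasMayerSeries_of_isWeight (hβ : 0 < β) (hβ' : β < 4 * Real.pi) (hX : MeasurableSet X)
    (hX0 : volume X ≠ 0) (hXt : volume X ≠ ⊤) (hg : IsWeight g) (hvm : Measurable v)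
    (hv : ∀ x, x ≠ 0 → v x = pot β g 1 x) :
    HasMayerSeries v X (mayerBound β) ((4 * Real.pi - β) / (4 * Real.pi * Real.exp 1 * β)) := by
  have hU := integrableOn_ursell hβ hβ' hX hXt hg hvm hv
  have hle := abs_mayerCoeff_le hβ hβ' hX hX0 hXt hg hv
  have hsum : ∀ z : ℂ, ‖z‖ < (4 * Real.pi - β) / (4 * Real.pi * Real.exp 1 * β) →
      Summable fun n : ℕ => ‖(mayerCoeff v X n : ℂ) * z ^ n‖ := by
    intro z hz
    refine (summable_mayerBound hβ hβ' (norm_nonneg z) hz).of_nonneg_of_le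
      (fun n => norm_nonneg _) fun n => ?_
    rw [norm_mul, norm_pow, Complex.norm_real, Real.norm_eq_abs]
    exact mul_le_mul_of_nonneg_right (hle n) (by positivity)
  exact
    { integrable_boltzmann := integrableOn_boltzmann hXt hU
      integrable_ursell := hU
      abs_coeff_le := hle
      summable := hsum
      hasSum_partition := fun z hz => hasSum_partitionCoeff hX0 hXt hU hsum hz }

end

theorem tendsto_mayerCoeff (hβ : 0 < β) (hβ' : β < 4 * Real.pi) (hX : MeasurableSet X)
    (hXt : volume X ≠ ⊤) {κ : ℝ → ℝ} (hκ : IsScaleFunction κ) (n : ℕ) :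
    Tendsto (fun t₀ => mayerCoeff (yukawaCutoff β κ t₀) X n) atBot
      (𝓝 (mayerCoeff (yukawa β) X n)) := by
  cases n with
  | zero => simp only [mayerCoeff_zero, tendsto_const_nhds_iff]
  | succ n =>
    unfold mayerCoeff stateIntegral
    refine Tendsto.const_mul _ (Tendsto.const_mul _ (tendsto_finsetSum _ fun σ _ => ?_))
    have hfin : ∫⁻ x in configs X (n + 1), majorant β (n + 1) Finset.univ 1 x ≠ ⊤ :=
      ((setLIntegral_majorant_le hβ hβ' hX n).trans_lt
        (ENNReal.mul_lt_top hXt.lt_top ENNReal.ofReal_lt_top)).ne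
    have hmaj := measurable_majorant_right (ι := Fin (n + 1)) β (n + 1) Finset.univ 1
    -- The majorant dominates the Ursell functions of all cutoffs `t ≤ 0` at once, since it does not
    -- depend on the weight.
    refine tendsto_integral_filter_of_dominated_convergence
      (fun x => (majorant β (n + 1) Finset.univ 1 x).toReal)
      (Eventually.of_forall fun t =>
        (measurable_ursell (measurable_yukawaCutoff β κ t) σ).aestronglyMeasurable)
      ?_ (integrable_toReal_of_lintegral_ne_top hmaj.aemeasurable hfin)
      (ae_restrict_of_ae ((ae_injective (n + 1)).mono fun x hx =>
        tendsto_ursell (fun y hy => tendsto_yukawaCutoff β hκ hy) σ hx))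
    filter_upwards [eventually_le_atBot (0 : ℝ)] with t ht
    filter_upwards [ae_restrict_of_ae (ae_injective (n + 1)), ae_lt_top hmaj hfin] with x hx hxt
    have h := ENNReal.toReal_mono hxt.ne (enorm_ursell_le hβ.le
      (isWeight_one_sub_massWeight (hκ.one_le ht))
      (fun y hy => yukawaCutoff_eq_pot hβ.le hκ ht hy) σ hx)
    rwa [toReal_enorm] at h

end Convergence

end YukawaGas

theorem mainTheorem3 (β : ℝ) (hβ : 0 < β) (hβ' : β < 4 * Real.pi) :
    ∃ c : ℕ → ℝ,
      (∀ r : ℝ, 0 ≤ r → r < (4 * Real.pi - β) / (4 * Real.pi * Real.exp 1 * β) →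
        Summable fun n : ℕ => c n * r ^ n) ∧
      (∀ X : Set YukawaGas.Plane, MeasurableSet X → volume X ≠ 0 → volume X ≠ ⊤ →
        (∀ κ : ℝ → ℝ, YukawaGas.IsScaleFunction κ → ∀ t₀ : ℝ, t₀ ≤ 0 →
          YukawaGas.HasMayerSeries (YukawaGas.yukawaCutoff β κ t₀) X c
            ((4 * Real.pi - β) / (4 * Real.pi * Real.exp 1 * β))) ∧
        YukawaGas.HasMayerSeries (YukawaGas.yukawa β) X c
          ((4 * Real.pi - β) / (4 * Real.pi * Real.exp 1 * β)) ∧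
        (∀ κ : ℝ → ℝ, YukawaGas.IsScaleFunction κ → ∀ n : ℕ,
          Tendsto (fun t₀ : ℝ => YukawaGas.mayerCoeff (YukawaGas.yukawaCutoff β κ t₀) X n) atBot
            (𝓝 (YukawaGas.mayerCoeff (YukawaGas.yukawa β) X n)))) := by
  refine ⟨YukawaGas.mayerBound β, fun r hr0 hr => YukawaGas.summable_mayerBound hβ hβ' hr0 hr,
    fun X hX hX0 hXt => ⟨fun κ hκ t₀ ht₀ => ?_, ?_, fun κ hκ n => ?_⟩⟩
  · exact YukawaGas.hasMayerSeries_of_isWeight hβ hβ' hX hX0 hXt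
      (YukawaGas.isWeight_one_sub_massWeight (hκ.one_le ht₀))
      (YukawaGas.measurable_yukawaCutoff β κ t₀)
      fun x hx => YukawaGas.yukawaCutoff_eq_pot hβ.le hκ ht₀ hx
  · exact YukawaGas.hasMayerSeries_of_isWeight hβ hβ' hX hX0 hXt
      (YukawaGas.isWeight_massWeight le_rfl) (YukawaGas.measurable_yukawa β)
      fun x hx => YukawaGas.yukawa_eq_pot β hx
  · exact YukawaGas.tendsto_mayerCoeff hβ hβ' hX hXt hκ n
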